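/- Let $G$ be a second countable, locally compact (Hausdorff) abelian group, written multiplicatively, with Pontryagin dual $\widehat G$, and let $\Lambda\subseteq G$ be a lattice, i.e. a discrete subgroup with $G/\Lambda$ compact; let $\Lambda^\perp=\{\tau\in\widehat G:\tau(\lambda)=1\text{ for all }\lambda\in\Lambda\}$. Fix Haar measures on $G$ and $\widehat G$. For $(x,\omega)\in G\times\widehat G$ and $\xi\in L^2(G)$ put $\pi(x,\omega)\xi(t)=\omega(t)\xi(x^{-1}t)$. The Feichtinger algebra is $$S_0(G)=\Big\{\xi\in L^2(G):\int_{G\times\widehat G}|\langle\xi,\pi(z)\xi\rangle|\,dz<\infty\Big\},$$ and the Zak transform of $\xi$ is $$Z_{G,\Lambda}\xi(x,\omega)=\sum_{\lambda\in\Lambda}\xi(x\lambda)\,\omega(\lambda),\qquad (x,\omega)\in G\times\widehat G.$$ Let $\xi\in S_0(G)$. Then $\xi$ has a unique continuous representative, and with $\xi$ identified with this representative, the series defining $Z_{G,\Lambda}\xi(x,\omega)$ converges absolutely for every $(x,\omega)\in G\times\widehat G$, and $Z_{G,\Lambda}\xi$ is continuous on $G\times\widehat G$. (Any other representative of $\xi$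 has the same Zak transform almost everywhere on $G\times\widehat G$.) Hence $Z_{G,\Lambda}$ maps $S_0(G)$ into the set of continuous quasiperiodic functions, that is, of the continuous $F:G\times\widehat G\to\mathbb C$ with $$F(x\lambda,\omega\tau)=\overline{\omega(\lambda)}\,F(x,\omega)\qquad\text{for all }(x,\omega)\in G\times\widehat G,\ (\lambda,\tau)\in\Lambda\times\Lambda^\perp.$$ -/

import Mathlib

open MeasureTheory

noncomputable section

/-- The annihilator of a subgroup `H` of `G`: the characters of `G` that are trivial on `H`. -/
def annihilator {G : Type*} [CommGroup G] [TopologicalSpace G] (H : Subgroup G) :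
    Subgroup (PontryaginDual G) where
  carrier := {ω | ∀ x ∈ H, ω x = 1}
  one_mem' := fun x _ => PontryaginDual.one_apply x
  mul_mem' := by
    intro a b ha hb x hx
    change a x * b x = 1
    rw [ha x hx, hb x hx, mul_one]
  inv_mem' := by
    intro a ha x hx
    change (a x)⁻¹ = 1
    rw [ha x hx, inv_one]

/-- A lattice is a discrete, cocompact subgroup. -/
structure IsLattice {G : Type*} [CommGroup G] [TopologicalSpace G] (Λ : Subgroup G) : Prop where
  discrete : DiscreteTopology Λ
  cocompact : CompactSpace (G ⧸ Λ)

/-- The time shift `T_x ξ (t) = ξ (x⁻¹ t)`. -/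
def timeShift {G : Type*} [CommGroup G] (x : G) (ξ : G → ℂ) : G → ℂ :=
  fun t => ξ (x⁻¹ * t)

/-- The frequency shift `M_ω ξ (t) = ω (t) ξ (t)`. -/
def freqShift {G : Type*} [CommGroup G] [TopologicalSpace G] (ω : PontryaginDual G)
    (ξ : G → ℂ) : G → ℂ :=
  fun t => (ω t : ℂ) * ξ t

/-- The time-frequency shift `π (x, ω) = M_ω T_x`. -/
def timeFreqShift {G : Type*} [CommGroup G] [TopologicalSpace G] (z : G × PontryaginDual G)
    (ξ : G → ℂ) : G → ℂ :=
  freqShift z.2 (timeShift z.1 ξ)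

/-- The pairing `⟨ξ, η⟩ = ∫ ξ (t) conj (η (t)) dμ (t)` of square integrable functions,
linear in the first variable. -/
def l2Inner {G : Type*} [MeasurableSpace G] (μ : Measure G) (ξ η : G → ℂ) : ℂ :=
  ∫ t, ξ t * star (η t) ∂μ

/-- The Feichtinger algebra `S₀(G)`: all `ξ ∈ L²(G)` such that `z ↦ ⟨ξ, π(z) ξ⟩` is integrable over
`G × Ĝ`. Here `μ` and `ν` are Haar measures on `G` and on its dual. -/
def feichtingerAlgebra {G : Type*} [CommGroup G] [TopologicalSpace G] [MeasurableSpace G]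
    [MeasurableSpace (PontryaginDual G)] (μ : Measure G) (ν : Measure (PontryaginDual G)) :
    Set (Lp ℂ 2 μ) :=
  {ξ | Integrable (fun z : G × PontryaginDual G => l2Inner μ ξ (timeFreqShift z ξ)) (μ.prod ν)}

/-- The terms `ξ (x λ) ω (λ)`, `λ ∈ Λ`, of the series that defines the Zak transform at `(x, ω)`. -/
def zakTerm {G : Type*} [CommGroup G] [TopologicalSpace G] (Λ : Subgroup G) (ξ : G → ℂ)
    (z : G × PontryaginDual G) (l : Λ) : ℂ :=
  ξ (z.1 * (l : G)) * (z.2 (l : G) : ℂ)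

/-- The Zak transform `Zξ (x, ω) = ∑ ξ (x λ) ω (λ)`, the sum being over `λ ∈ Λ`. -/
def zak {G : Type*} [CommGroup G] [TopologicalSpace G] (Λ : Subgroup G) (ξ : G → ℂ) :
    G × PontryaginDual G → ℂ :=
  fun z => ∑' l : Λ, zakTerm Λ ξ z l

/-- The continuous quasiperiodic functions on `G × Ĝ`: the continuous `F` such that
`F (x λ, ω τ) = conj (ω (λ)) F (x, ω)` for all `λ ∈ Λ` and all `τ` in the annihilator of `Λ`. -/
def continuousQuasiperiodic {G : Type*} [CommGroup G] [TopologicalSpace G] (Λ : Subgroup G) :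
    Set (G × PontryaginDual G → ℂ) :=
  {F | Continuous F ∧ ∀ (x : G) (ω : PontryaginDual G), ∀ l ∈ Λ, ∀ τ ∈ annihilator Λ,
    F (x * l, ω * τ) = star (ω l : ℂ) * F (x, ω)}

end

open MeasureTheory

/-! Write V(x, ω) = ⟨ξ, π(x, ω)ξ⟩. Everything rests on a reconstruction formula
(`exists_reconstruction`): for h continuous with compact support, ξ(t) ∫ ξ̄ h = c ∫ V(x, ω) ω(t)
h(x⁻¹t) d(x, ω) for almost every t. As V is integrable, the right side is continuous in t; if ξ ≠ 0,
some h has nonzero pairing with ξ, and dividing by it gives the continuous representative. For t in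
a compact K, only x in l K (supp h)⁻¹ contributes to the value at tl. Since Λ is discrete, every x
lies in a bounded number of these sets, so the bounds on |ξ(tl)| sum over l to at most a multiple of
∫|V| (`exists_summable_bound`). The Weierstrass test then gives absolute convergence and continuity
of the Zak transform.

The reconstruction formula is Parseval's identity applied, for almost every x, to t ↦ ξ(t) conj
ξ(x⁻¹t), whose Fourier transform is V(x, ·). Parseval is derived from spectral theory. The regular
representation and its convolution operators generate a commutative C⋆-algebra, so Gelfand duality
and the Riesz theorem give each vector v a finite spectral measure m_v on the dual
(`exists_spectral_measure`). For f, h continuous with compact support, (χh) ∗ f = χ · (h ∗ χ̄f)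
relates m_f weighted by a translate of |ĥ|² to m_h weighted by a translate of |f̂|²
(`spectralMeasure_commutation`). Averaging over χ with Haar measure ν shows that m_h = c |ĥ|² ν with
c independent of h (`exists_spectralMeasure_eq`). -/

noncomputable section

/-! ### Positive functionals and Gelfand duality -/

open WeakDual CompactlySupported ComplexOrder in
-- Under the Gelfand isomorphism a nonnegative function is the square of its real root, so Φ becomes
-- a positive functional on continuous functions, to which Riesz–Markov applies. The character space
-- is compact because A is unital, hence the measure is finite.
theorem exists_finite_measure_of_positive_functional {A : Type*} [CommCStarAlgebra A]
    [MeasurableSpace (characterSpace ℂ A)] [BorelSpace (characterSpace ℂ A)]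
    (Φ : A →ₗ[ℂ] ℂ) (hΦ : ∀ a, 0 ≤ Φ (star a * a)) :
    ∃ m : Measure (characterSpace ℂ A), IsFiniteMeasure m ∧ ∀ a, Φ a = ∫ θ, θ a ∂m := by
  let e := gelfandStarTransform A
  let Ψ : C(characterSpace ℂ A, ℂ) →ₗ[ℂ] ℂ :=
    { toFun := fun F => Φ (e.symm F)
      map_add' := fun F K => by rw [map_add, map_add]
      map_smul' := fun c F => by rw [map_smul, map_smul]; rfl }
  have hΨ : ∀ F : C(characterSpace ℂ A, ℂ), 0 ≤ Ψ (star F * F) := by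
    intro F
    have : Ψ (star F * F) = Φ (star (e.symm F) * e.symm F) := by
      change Φ (e.symm (star F * F)) = _
      rw [map_mul, map_star]
    rw [this]; exact hΦ _
  let ι : C(characterSpace ℂ A, ℝ) → C(characterSpace ℂ A, ℂ) := fun F =>
    ⟨fun θ => (F θ : ℂ), Complex.continuous_ofReal.comp F.continuous⟩
  have hpos : ∀ F : C(characterSpace ℂ A, ℝ), (∀ θ, 0 ≤ F θ) → 0 ≤ Ψ (ι F) := by
    intro F hF
    have h : ι F = star (ι ⟨fun θ => √(F θ), F.continuous.sqrt⟩) *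
        ι ⟨fun θ => √(F θ), F.continuous.sqrt⟩ := by
      ext θ
      simp only [ι, ContinuousMap.mul_apply, ContinuousMap.star_apply, ContinuousMap.coe_mk,
        RCLike.star_def, Complex.conj_ofReal]
      rw [← Complex.ofReal_mul, Real.mul_self_sqrt (hF θ)]
    rw [h]; exact hΨ _
  have hadd : ∀ F K, ι (F + K) = ι F + ι K := by intro F K; ext; simp [ι]
  have hsmul : ∀ (c : ℝ) F, ι (c • F) = (c : ℂ) • ι F := by intro c F; ext; simp [ι]
  let Λ₀ : C_c(characterSpace ℂ A, ℝ) →ₗ[ℝ] ℝ :=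
    { toFun := fun F => (Ψ (ι F.toContinuousMap)).re
      map_add' := by
        intro F K
        change (Ψ (ι (F.toContinuousMap + K.toContinuousMap))).re = _
        rw [hadd, map_add, Complex.add_re]
      map_smul' := by
        intro c F
        change (Ψ (ι (c • F.toContinuousMap))).re = _
        rw [hsmul, map_smul, smul_eq_mul, Complex.re_ofReal_mul]; rfl }
  let Λ : C_c(characterSpace ℂ A, ℝ) →ₚ[ℝ] ℝ := PositiveLinearMap.mk₀ Λ₀ (by
    intro F hF
    exact (Complex.le_def.1 (hpos F.toContinuousMap hF)).1)
  let m := RealRMK.rieszMeasure Λ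
  have hm : ∀ F : C(characterSpace ℂ A, ℝ), ∫ θ, F θ ∂m = (Ψ (ι F)).re := by
    intro F
    exact RealRMK.integral_rieszMeasure Λ ⟨F, HasCompactSupport.of_compactSpace _⟩
  have him : ∀ F : C(characterSpace ℂ A, ℝ), (Ψ (ι F)).im = 0 := by
    intro F
    have h1 : F = ⟨fun θ => max (F θ) 0, by fun_prop⟩ +
        (-1 : ℝ) • ⟨fun θ => max (-F θ) 0, by fun_prop⟩ := by
      ext θ
      simp only [ContinuousMap.add_apply, ContinuousMap.coe_mk, ContinuousMap.smul_apply,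
        smul_eq_mul, neg_mul, one_mul]
      rcases le_total (F θ) 0 with h | h <;> simp [h]
    rw [h1, hadd, hsmul, map_add, map_smul, Complex.add_im, smul_eq_mul, Complex.im_ofReal_mul,
      ← (Complex.le_def.1 (hpos ⟨fun θ => max (F θ) 0, by fun_prop⟩ fun θ => le_max_right _ _)).2,
      ← (Complex.le_def.1 (hpos ⟨fun θ => max (-F θ) 0, by fun_prop⟩ fun θ => le_max_right _ _)).2]
    simp
  have hfin : IsFiniteMeasure m := ⟨isCompact_univ.measure_lt_top⟩
  refine ⟨m, hfin, fun a => ?_⟩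
  let F₁ : C(characterSpace ℂ A, ℝ) := ⟨fun θ => (e a θ).re, by fun_prop⟩
  let F₂ : C(characterSpace ℂ A, ℝ) := ⟨fun θ => (e a θ).im, by fun_prop⟩
  have hdec : e a = ι F₁ + Complex.I • ι F₂ := by
    ext θ
    simp only [ι, F₁, F₂, ContinuousMap.add_apply, ContinuousMap.smul_apply, ContinuousMap.coe_mk,
      smul_eq_mul]
    rw [mul_comm, Complex.re_add_im]
  have hval : Φ a = Ψ (e a) := by
    change Φ a = Φ (e.symm (e a)); rw [e.symm_apply_apply]
  have hre : ∀ F, Ψ (ι F) = ((∫ θ, F θ ∂m : ℝ) : ℂ) := by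
    intro F; rw [hm]; exact Complex.ext (by simp) (by simp [him])
  have hint : ∀ F : C(characterSpace ℂ A, ℂ), Integrable F m := fun F =>
    F.continuous.integrable_of_hasCompactSupport (HasCompactSupport.of_compactSpace _)
  rw [hval, hdec, map_add, map_smul, hre, hre, ← integral_complex_ofReal, ← integral_complex_ofReal,
    smul_eq_mul, ← integral_const_mul, ← integral_add]
  · refine integral_congr_ae (Filter.Eventually.of_forall fun θ => ?_)
    change ((e a θ).re : ℂ) + Complex.I * ((e a θ).im : ℂ) = θ a
    rw [mul_comm, Complex.re_add_im]; rfl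
  · exact hint (ι F₁)
  · exact (hint (ι F₂)).const_mul _

/-- The Fourier transform of a function on a commutative topological group. -/
def groupFourier {G : Type*} [CommGroup G] [TopologicalSpace G] [MeasurableSpace G]
    (μ : Measure G) (g : G → ℂ) (ω : PontryaginDual G) : ℂ :=
  ∫ t, g t * star (ω t : ℂ) ∂μ

/-! ### From the character space of the algebra to the dual group -/

section Spectral

set_option linter.unusedSectionVars false

variable {G : Type*} [CommGroup G] [TopologicalSpace G] [IsTopologicalGroup G]
  [LocallyCompactSpace G] [T2Space G] [SecondCountableTopology G]
  [MeasurableSpace G] [BorelSpace G] {μ : Measure G} [μ.IsHaarMeasure]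

/-- Translation of an `Lᵖ` function, `(τ_x g) (t) = g (x⁻¹ t)`. -/
def lpTranslate {p : ENNReal} (x : G) (g : Lp ℂ p μ) : Lp ℂ p μ :=
  DomMulAct.mk x⁻¹ • g

theorem coeFn_lpTranslate {p : ENNReal} (x : G) (g : Lp ℂ p μ) :
    lpTranslate x g =ᵐ[μ] fun t => g (x⁻¹ * t) :=
  DomMulAct.smul_Lp_ae_eq _ g

theorem continuous_lpTranslate {p : ENNReal} [Fact (1 ≤ p)] [Fact (p ≠ ⊤)] (g : Lp ℂ p μ) :
    Continuous fun x : G => lpTranslate x g := by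
  have h : Continuous fun x : G => DomMulAct.mk x⁻¹ :=
    DomMulAct.continuous_mk.comp continuous_inv
  exact h.smul continuous_const

theorem lpTranslate_mul {p : ENNReal} (x y : G) (g : Lp ℂ p μ) :
    lpTranslate (x * y) g = lpTranslate x (lpTranslate y g) := by
  simp only [lpTranslate, smul_smul, ← DomMulAct.mk_mul, mul_inv_rev]

theorem norm_lpTranslate {p : ENNReal} (x : G) (g : Lp ℂ p μ) : ‖lpTranslate x g‖ = ‖g‖ :=
  DomMulAct.norm_smul_Lp _ _

instance : Fact ((1 : ENNReal) ≠ ⊤) := ⟨ENNReal.one_ne_top⟩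

instance : SecondCountableTopology (PontryaginDual G) :=
  (ContinuousMonoidHom.isInducing_toContinuousMap G Circle).secondCountableTopology

theorem continuous_dual_eval : Continuous fun z : PontryaginDual G × G => z.1 z.2 := by
  have h : Continuous fun z : C(G, Circle) × G => z.1 z.2 := ContinuousEval.continuous_eval
  exact h.comp (((ContinuousMonoidHom.isInducing_toContinuousMap G Circle).continuous.comp
    continuous_fst).prodMk continuous_snd)

theorem continuous_dual_coe : Continuous fun z : PontryaginDual G × G => (z.1 z.2 : ℂ) :=
  continuous_induced_dom.comp continuous_dual_eval

open WeakDual in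
theorem norm_characterSpace_apply_of_unitary {A : Type*} [CommCStarAlgebra A] {a : A}
    (h : star a * a = 1) (θ : characterSpace ℂ A) : ‖θ a‖ = 1 := by
  have h1 : star (θ a) * θ a = 1 := by rw [← map_star, ← map_mul, h, map_one]
  have h2 : ‖θ a‖ * ‖θ a‖ = 1 := by
    rw [← norm_star (θ a)]
    nth_rw 2 [norm_star]
    rw [← norm_mul, h1, norm_one]
  nlinarith [norm_nonneg (θ a)]

open WeakDual in
theorem continuous_characterSpace_apply {A X : Type*} [CommCStarAlgebra A] [TopologicalSpace X]
    {a : X → A} (ha : Continuous a) :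
    Continuous fun z : characterSpace ℂ A × X => z.1 (a z.2) := by
  have h1 : Continuous (gelfandTransform ℂ A) := (gelfandTransform_isometry A).continuous
  have h2 : Continuous fun z : characterSpace ℂ A × X => gelfandTransform ℂ A (a z.2) z.1 :=
    ContinuousEval.continuous_eval.comp ((h1.comp (ha.comp continuous_snd)).prodMk continuous_fst)
  exact h2

theorem integrable_smul_lpTranslate {A : Type*} [NormedAddCommGroup A] [NormedSpace ℂ A]
    (l : Lp ℂ 1 μ →L[ℂ] A) (g h : Lp ℂ 1 μ) :
    Integrable (fun x => g x • l (lpTranslate x h)) μ := by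
  refine (L1.integrable_coeFn g).smul_bdd (‖l‖ * ‖h‖) ?_ ?_
  · exact (l.continuous.comp (continuous_lpTranslate h)).aestronglyMeasurable
  · refine Filter.Eventually.of_forall fun x => ?_
    rw [← norm_lpTranslate x h]
    exact l.le_opNorm _

theorem continuous_groupFourier {g : G → ℂ} (hg : Integrable g μ) :
    Continuous (groupFourier μ g) := by
  refine continuous_of_dominated (bound := fun x => ‖g x‖) ?_ ?_ hg.norm ?_
  · intro ω
    refine hg.aestronglyMeasurable.mul ?_
    exact (continuous_star.comp (continuous_dual_coe.comp
      (continuous_const.prodMk continuous_id))).aestronglyMeasurable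
  · intro ω
    refine Filter.Eventually.of_forall fun x => ?_
    rw [norm_mul, norm_star, Circle.norm_coe, mul_one]
  · refine Filter.Eventually.of_forall fun x => continuous_const.mul ?_
    exact continuous_star.comp (continuous_dual_coe.comp (continuous_id.prodMk continuous_const))

open WeakDual ComplexOrder in
/-- The spectral measure on the dual group of a positive functional on a commutative
`C⋆`-algebra that contains a compatible unitary representation `t` of the group and its
integrated form `l`. -/
theorem exists_dual_measure_of_positive_functional {A : Type*} [CommCStarAlgebra A]
    (t : G →* A) (ht : ∀ x, star (t x) * t x = 1) (l : Lp ℂ 1 μ →L[ℂ] A)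
    (htl : ∀ x g, t x * l g = l (lpTranslate x g))
    (hl : ∀ g h, l g * l h = ∫ x, g x • (t x * l h) ∂μ)
    [MeasurableSpace (PontryaginDual G)] [BorelSpace (PontryaginDual G)]
    (Φ : A →ₗ[ℂ] ℂ) (hΦ : ∀ a, 0 ≤ Φ (star a * a)) :
    ∃ m : Measure (PontryaginDual G), IsFiniteMeasure m ∧
      (∀ g : Lp ℂ 1 μ, Φ (l g) = ∫ ω, groupFourier μ g ω ∂m) ∧
      ∀ (x : G) (g : Lp ℂ 1 μ), Φ (star (l g) * t x * l g) =
        ∫ ω, star (ω x : ℂ) * (‖groupFourier μ g ω‖ : ℂ) ^ 2 ∂m := by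
  let : MeasurableSpace (characterSpace ℂ A) := borel _
  have : BorelSpace (characterSpace ℂ A) := ⟨rfl⟩
  obtain ⟨m, hm, hmΦ⟩ := exists_finite_measure_of_positive_functional Φ hΦ
  -- A θ that kills the image of L¹ need not come from a continuous character of G. Such θ are
  -- discarded; the functions to be integrated vanish there.
  let D : Set (characterSpace ℂ A) := {θ | ∃ g, θ (l g) ≠ 0}
  have hevc : ∀ a : A, Continuous fun θ : characterSpace ℂ A => θ a := fun a =>
    map_continuous (gelfandTransform ℂ A a)
  have hD : IsOpen D := by
    have : D = ⋃ g, {θ | θ (l g) ≠ 0} := by ext; simp [D]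
    rw [this]
    exact isOpen_iUnion fun g => isOpen_ne_fun (hevc _) continuous_const
  -- The map t is not assumed continuous, but x ↦ l(τ_x g) is norm continuous. Near a θ₀ with θ₀(l
  -- g) ≠ 0, one has θ(t x) = θ(l(τ_x g)) / θ(l g).
  have hjoint : Continuous fun z : D × G => (z.1 : characterSpace ℂ A) (t z.2) := by
    rw [continuous_iff_continuousAt]
    rintro ⟨θ₀, x₀⟩
    obtain ⟨g, hg⟩ := θ₀.2
    have h1 : Continuous fun z : D × G => (z.1 : characterSpace ℂ A) (l (lpTranslate z.2 g)) :=
      (continuous_characterSpace_apply (l.continuous.comp (continuous_lpTranslate g))).comp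
        ((continuous_subtype_val.comp continuous_fst).prodMk continuous_snd)
    have h2 : Continuous fun z : D × G => (z.1 : characterSpace ℂ A) (l g) :=
      (hevc _).comp (continuous_subtype_val.comp continuous_fst)
    have h3 : ContinuousAt (fun z : D × G => (z.1 : characterSpace ℂ A) (l (lpTranslate z.2 g)) /
        (z.1 : characterSpace ℂ A) (l g)) (θ₀, x₀) := h1.continuousAt.div h2.continuousAt hg
    refine h3.congr ?_
    filter_upwards [h2.continuousAt.eventually_ne hg] with z hz
    rw [← htl, map_mul, mul_div_cancel_right₀ _ hz]
  obtain ⟨u, hu⟩ : ∃ u : D → G → Circle, ∀ θ x, (u θ x : ℂ) = (θ : characterSpace ℂ A) (t x) :=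
    ⟨fun θ x => ⟨(θ : characterSpace ℂ A) (t x), mem_sphere_zero_iff_norm.2
      (norm_characterSpace_apply_of_unitary (ht x) _)⟩, fun θ x => rfl⟩
  have huc : Continuous fun z : D × G => u z.1 z.2 := by
    refine continuous_induced_rng.2 (hjoint.congr fun z => (hu z.1 z.2).symm)
  -- The inverse matches the conjugate in `groupFourier`: it makes the Fourier transform of g at
  -- q(θ) equal to θ(l g).
  let q : D → PontryaginDual G := fun θ =>
    (({ toFun := fun x => (u θ x)⁻¹
        map_one' := by ext; simp [hu]
        map_mul' := by intro x y; ext; simp [hu, mul_comm]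
        continuous_toFun := (huc.comp (continuous_const.prodMk continuous_id)).inv } :
          G →ₜ* Circle) :)
  have hqval : ∀ θ x, star (q θ x : ℂ) = (θ : characterSpace ℂ A) (t x) := by
    intro θ x
    change star (((u θ x)⁻¹ : Circle) : ℂ) = _
    rw [Circle.coe_inv_eq_conj, ← starRingEnd_apply, Complex.conj_conj, hu]
  have hq : Continuous q :=
    ContinuousMonoidHom.continuous_of_continuous_uncurry _ huc.inv
  have hF : ∀ (θ : D) (g : Lp ℂ 1 μ), groupFourier μ g (q θ) = (θ : characterSpace ℂ A) (l g) := by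
    intro θ g
    obtain ⟨h, hh⟩ := θ.2
    have hint : Integrable (fun x => g x • (t x * l h)) μ := by
      simpa only [htl] using integrable_smul_lpTranslate l g h
    have h1 : (θ : characterSpace ℂ A) (l g * l h) =
        ∫ x, (θ : characterSpace ℂ A) (g x • (t x * l h)) ∂μ := by
      rw [hl]
      exact ((CharacterSpace.toCLM (θ : characterSpace ℂ A)).integral_comp_comm hint).symm
    simp only [map_mul, map_smul, smul_eq_mul, ← mul_assoc] at h1
    rw [integral_mul_const] at h1
    rw [mul_right_cancel₀ hh h1, groupFourier]
    simp only [hqval]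
  have hint : ∀ F : PontryaginDual G → ℂ, ∀ a : A, AEStronglyMeasurable F
      ((m.comap (Subtype.val : D → _)).map q) → (∀ θ : D, F (q θ) = (θ : characterSpace ℂ A) a) →
      (∀ θ ∉ D, θ a = 0) → Φ a = ∫ ω, F ω ∂((m.comap (Subtype.val : D → _)).map q) := by
    intro F a hFm h1 h2
    rw [hmΦ, integral_map hq.measurable.aemeasurable hFm]
    simp only [h1]
    rw [integral_subtype_comap hD.measurableSet (fun θ => θ a)]
    exact (setIntegral_eq_integral_of_forall_compl_eq_zero h2).symm
  have hFc : ∀ g : Lp ℂ 1 μ, Continuous (groupFourier μ g) := fun g =>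
    continuous_groupFourier (L1.integrable_coeFn g)
  have hnot : ∀ g, ∀ θ ∉ D, θ (l g) = 0 := fun g θ hθ => by
    by_contra hc; exact hθ ⟨g, hc⟩
  refine ⟨(m.comap (Subtype.val : D → _)).map q, ?_, ?_, ?_⟩
  · have : IsFiniteMeasure (m.comap (Subtype.val : D → _)) :=
      ⟨by rw [(MeasurableEmbedding.subtype_coe hD.measurableSet).comap_apply]
          exact measure_lt_top _ _⟩
    infer_instance
  · intro g
    exact hint _ _ (hFc g).aestronglyMeasurable (fun θ => hF θ g) (hnot g)
  · intro x g
    refine hint _ _ ?_ ?_ ?_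
    · refine Continuous.aestronglyMeasurable ?_
      refine Continuous.mul ?_ ?_
      · exact continuous_star.comp
          (continuous_dual_coe.comp (continuous_id.prodMk continuous_const))
      · exact (Complex.continuous_ofReal.comp (hFc g).norm).pow 2
    · intro θ
      rw [hqval, hF, map_mul, map_mul, map_star, mul_comm (star _), mul_assoc, RCLike.star_def,
        Complex.conj_mul']
    · intro θ hθ
      rw [map_mul, hnot g θ hθ, mul_zero]

end Spectral

/-! ### Spectral measures of unitary representations -/

section Integrated

set_option linter.unusedSectionVars false

variable {G : Type*} [CommGroup G] [TopologicalSpace G] [IsTopologicalGroup G]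
  [LocallyCompactSpace G] [T2Space G] [SecondCountableTopology G]
  [MeasurableSpace G] [BorelSpace G] {μ : Measure G} [μ.IsHaarMeasure]
  {H : Type*} [NormedAddCommGroup H] [InnerProductSpace ℂ H] [CompleteSpace H]
  (T : G →* (H →L[ℂ] H)) (hn : ∀ x u, ‖T x u‖ = ‖u‖) (hc : ∀ u, Continuous fun x => T x u)

include hn hc in
theorem integrable_smul_representation {g : G → ℂ} (hg : Integrable g μ) (u : H) :
    Integrable (fun x => g x • T x u) μ :=
  hg.smul_bdd ‖u‖ (hc u).aestronglyMeasurable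
    (Filter.Eventually.of_forall fun x => (hn x u).le)

/-- The integrated form `g ↦ ∫ g (x) T_x dx` of a strongly continuous isometric representation. -/
def integratedForm : Lp ℂ 1 μ →L[ℂ] (H →L[ℂ] H) :=
  LinearMap.mkContinuous₂
    (LinearMap.mk₂ ℂ (fun (g : Lp ℂ 1 μ) (u : H) => ∫ x, g x • T x u ∂μ)
      (by
        intro g h u
        rw [← integral_add (integrable_smul_representation T hn hc (L1.integrable_coeFn g) u)
          (integrable_smul_representation T hn hc (L1.integrable_coeFn h) u)]
        refine integral_congr_ae ?_
        filter_upwards [Lp.coeFn_add g h] with x hx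
        rw [hx, Pi.add_apply, add_smul])
      (by
        intro c g u
        rw [← integral_smul]
        refine integral_congr_ae ?_
        filter_upwards [Lp.coeFn_smul c g] with x hx
        rw [hx, Pi.smul_apply, smul_assoc])
      (by
        intro g u v
        rw [← integral_add (integrable_smul_representation T hn hc (L1.integrable_coeFn g) u)
          (integrable_smul_representation T hn hc (L1.integrable_coeFn g) v)]
        simp only [map_add, smul_add])
      (by
        intro c g u
        rw [← integral_smul]
        simp only [map_smul, smul_comm c]))
    1
    (by
      intro g u
      rw [one_mul, LinearMap.mk₂_apply, L1.norm_eq_integral_norm, ← integral_mul_const]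
      refine (norm_integral_le_integral_norm _).trans_eq ?_
      simp only [norm_smul, hn])

theorem integratedForm_apply (g : Lp ℂ 1 μ) (u : H) :
    integratedForm T hn hc g u = ∫ x, g x • T x u ∂μ := rfl

theorem representation_mul_integratedForm (x : G) (g : Lp ℂ 1 μ) :
    T x * integratedForm T hn hc g = integratedForm T hn hc (lpTranslate x g) := by
  ext u
  rw [mul_apply_eq_comp, integratedForm_apply, integratedForm_apply,
    ← (T x).integral_comp_comm (integrable_smul_representation T hn hc (L1.integrable_coeFn g) u)]
  have h1 : ∫ y, (lpTranslate x g : Lp ℂ 1 μ) y • T y u ∂μ = ∫ y, g (x⁻¹ * y) • T y u ∂μ := by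
    refine integral_congr_ae ?_
    filter_upwards [coeFn_lpTranslate x g] with y hy
    rw [hy]
  rw [h1, ← integral_mul_left_eq_self (fun y => g (x⁻¹ * y) • T y u) x]
  simp only [inv_mul_cancel_left, map_mul, map_smul, mul_apply_eq_comp]

theorem commute_integratedForm (B : H →L[ℂ] H) (hB : ∀ x, B * T x = T x * B) (g : Lp ℂ 1 μ) :
    B * integratedForm T hn hc g = integratedForm T hn hc g * B := by
  ext u
  rw [mul_apply_eq_comp, mul_apply_eq_comp, integratedForm_apply,
    integratedForm_apply,
    ← B.integral_comp_comm (integrable_smul_representation T hn hc (L1.integrable_coeFn g) u)]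
  congr 1
  ext x
  rw [map_smul]
  congr 1
  exact congrArg (fun S : H →L[ℂ] H => S u) (hB x)

include hn in
theorem star_representation_mul (x : G) : star (T x) * T x = 1 :=
  (ContinuousLinearMap.norm_map_iff_adjoint_comp_self _).1 (hn x)

include hn in
theorem star_representation (x : G) : star (T x) = T x⁻¹ := by
  have h := congrArg (· * T x⁻¹) (star_representation_mul T hn x)
  simpa [mul_assoc, ← map_mul] using h

/-- The adjoint of T x is T x⁻¹, so this is the adjoint of the commutation with T x⁻¹. It supplies
the relations between generators and adjoints needed for a commutative star algebra. -/
theorem star_integratedForm_comm (x : G) (g : Lp ℂ 1 μ) :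
    star (integratedForm T hn hc g) * T x = T x * star (integratedForm T hn hc g) := by
  have h := commute_integratedForm T hn hc (T x⁻¹)
    (fun y => by rw [← map_mul, ← map_mul, mul_comm]) g
  have h2 := congrArg star h
  rw [star_mul, star_mul, star_representation T hn, inv_inv] at h2
  exact h2

/-- The operators of a representation together with those of its integrated form. -/
def representationOperators : Set (H →L[ℂ] H) :=
  Set.range T ∪ Set.range (integratedForm (μ := μ) T hn hc)

theorem isMulCommutative_adjoin_representationOperators :
    IsMulCommutative (StarAlgebra.adjoin ℂ (representationOperators (μ := μ) T hn hc)) := by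
  have hTT : ∀ x y, T x * T y = T y * T x := fun x y => by rw [← map_mul, ← map_mul, mul_comm]
  refine StarAlgebra.isMulCommutative_adjoin ℂ ?_ ?_
  · rintro _ (⟨x, rfl⟩ | ⟨g, rfl⟩) _ (⟨y, rfl⟩ | ⟨h, rfl⟩)
    · exact hTT x y
    · exact commute_integratedForm T hn hc _ (hTT x) h
    · exact (commute_integratedForm T hn hc _ (hTT y) g).symm
    · exact commute_integratedForm T hn hc _
        (fun x => (commute_integratedForm T hn hc _ (hTT x) g).symm) h
  · rintro _ (⟨x, rfl⟩ | ⟨g, rfl⟩) _ (⟨y, rfl⟩ | ⟨h, rfl⟩)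
    · rw [star_representation T hn]; exact hTT x _
    · exact (star_integratedForm_comm T hn hc x h).symm
    · rw [star_representation T hn]; exact (commute_integratedForm T hn hc _ (hTT _) g).symm
    · exact (commute_integratedForm T hn hc _ (star_integratedForm_comm T hn hc · h) g).symm

/-- The `C⋆`-algebra generated by a representation and its integrated form. -/
abbrev representationAlgebra : StarSubalgebra ℂ (H →L[ℂ] H) :=
  (StarAlgebra.adjoin ℂ (representationOperators (μ := μ) T hn hc)).topologicalClosure

/-- The `C⋆`-algebra generated by a representation of an abelian group is commutative. -/
abbrev representationAlgebraCommCStarAlgebra :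
    CommCStarAlgebra (representationAlgebra (μ := μ) T hn hc) :=
  haveI : IsClosed ((representationAlgebra (μ := μ) T hn hc : StarSubalgebra ℂ (H →L[ℂ] H)) :
    Set (H →L[ℂ] H)) := StarSubalgebra.isClosed_topologicalClosure _
  { (inferInstance : CStarAlgebra (representationAlgebra (μ := μ) T hn hc)) with
    mul_comm := (StarSubalgebra.commRingTopologicalClosure _
      (isMulCommutative_adjoin_representationOperators (μ := μ) T hn hc).is_comm.comm).mul_comm }

open ComplexOrder in
/-- The spectral measure of a vector for a unitary representation of an abelian group. -/
theorem exists_spectral_measure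
    [MeasurableSpace (PontryaginDual G)] [BorelSpace (PontryaginDual G)] (v : H) :
    ∃ m : Measure (PontryaginDual G), IsFiniteMeasure m ∧
      (∀ g : Lp ℂ 1 μ, inner ℂ v (integratedForm T hn hc g v) = ∫ ω, groupFourier μ g ω ∂m) ∧
      ∀ (x : G) (g : Lp ℂ 1 μ),
        inner ℂ (integratedForm T hn hc g v) (T x (integratedForm T hn hc g v)) =
        ∫ ω, star (ω x : ℂ) * (‖groupFourier μ g ω‖ : ℂ) ^ 2 ∂m := by
  let A := representationAlgebra (μ := μ) T hn hc
  let iA : CommCStarAlgebra A := representationAlgebraCommCStarAlgebra T hn hc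
  have hsub : ∀ a ∈ representationOperators (μ := μ) T hn hc, a ∈ A := fun a ha =>
    StarSubalgebra.le_topologicalClosure _ (StarAlgebra.subset_adjoin ℂ _ ha)
  let t : G →* A :=
    { toFun := fun x => ⟨T x, hsub _ (Or.inl ⟨x, rfl⟩)⟩
      map_one' := Subtype.ext (map_one T)
      map_mul' := fun x y => Subtype.ext (map_mul T x y) }
  let l : Lp ℂ 1 μ →L[ℂ] A :=
    { toFun := fun g => ⟨integratedForm T hn hc g, hsub _ (Or.inr ⟨g, rfl⟩)⟩
      map_add' := fun g h => Subtype.ext (map_add _ g h)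
      map_smul' := fun c g => Subtype.ext (map_smul _ c g)
      cont := (integratedForm T hn hc).continuous.subtype_mk _ }
  let ev : H → A →L[ℂ] H := fun u =>
    { toFun := fun a => (a : H →L[ℂ] H) u
      map_add' := fun a b => rfl
      map_smul' := fun c a => rfl
      cont := (ContinuousLinearMap.apply ℂ H u).continuous.comp continuous_subtype_val }
  have htl : ∀ x g, t x * l g = l (lpTranslate x g) := fun x g =>
    Subtype.ext (representation_mul_integratedForm T hn hc x g)
  have hl : ∀ g h, l g * l h = ∫ x, g x • (t x * l h) ∂μ := by
    intro g h
    -- Although T is only strongly continuous, t x * l h = l(τ_x h) is norm continuous in x, so the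
    -- integral exists in A and may be evaluated at each vector.
    have hint : Integrable (fun x => g x • (t x * l h)) μ := by
      simpa only [htl] using integrable_smul_lpTranslate l g h
    refine Subtype.ext (ContinuousLinearMap.ext fun u => ?_)
    change _ = ev u (∫ x, g x • (t x * l h) ∂μ)
    rw [← (ev u).integral_comp_comm hint]
    rfl
  let Φ : A →ₗ[ℂ] ℂ :=
    { toFun := fun a => inner ℂ v ((a : H →L[ℂ] H) v)
      map_add' := fun a b => inner_add_right v _ _
      map_smul' := fun c a => inner_smul_right v _ c }
  obtain ⟨m, hm, h1, h2⟩ := exists_dual_measure_of_positive_functional t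
    (fun x => Subtype.ext (star_representation_mul T hn x)) l htl hl Φ (by
      intro a
      change 0 ≤ inner ℂ v ((ContinuousLinearMap.adjoint (a : H →L[ℂ] H)) ((a : H →L[ℂ] H) v))
      rw [ContinuousLinearMap.adjoint_inner_right]
      rw [inner_self_eq_norm_sq_to_K]
      exact (Complex.zero_le_real.2 (sq_nonneg ‖(a : H →L[ℂ] H) v‖)).trans_eq (by push_cast; rfl))
  refine ⟨m, hm, h1, fun x g => ?_⟩
  rw [← h2]
  change _ = inner ℂ v ((ContinuousLinearMap.adjoint (integratedForm T hn hc g)) (T x _))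
  rw [ContinuousLinearMap.adjoint_inner_right]
  rfl

end Integrated

/-! ### The regular representation and convolution -/

section Regular

set_option linter.unusedSectionVars false

variable {G : Type*} [CommGroup G] [TopologicalSpace G] [IsTopologicalGroup G]
  [LocallyCompactSpace G] [T2Space G] [SecondCountableTopology G]
  [MeasurableSpace G] [BorelSpace G] {μ : Measure G} [μ.IsHaarMeasure]

/-- The indicator of a compact K is a bounded pointwise limit of continuous functions. Multiplying
these by a cutoff equal to 1 on K gives compact support, and dominated convergence makes the
integral of D over K vanish. -/
theorem ae_eq_zero_of_forall_integral_compactlySupported {X : Type*} [TopologicalSpace X]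
    [LocallyCompactSpace X] [T2Space X] [SecondCountableTopology X] [MeasurableSpace X]
    [BorelSpace X] {μ : Measure X} {D : X → ℂ} (hD : LocallyIntegrable D μ)
    (h : ∀ k : X → ℂ, Continuous k → HasCompactSupport k → ∫ t, k t * D t ∂μ = 0) :
    D =ᵐ[μ] 0 := by
  refine ae_eq_zero_of_forall_setIntegral_isCompact_eq_zero' hD fun K hK => ?_
  obtain ⟨φ, hφ1, -, hφc, hφ01⟩ := exists_continuous_one_zero_of_isCompact hK isClosed_empty
    (Set.disjoint_empty K)
  let a : ℕ → X → ℂ := fun n t => ((hK.isClosed.apprSeq n t : ℝ) : ℂ) * (φ t : ℂ)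
  have hφi : Integrable (fun t => (φ t : ℂ) * D t) μ := by
    refine hD.integrable_smul_left_of_hasCompactSupport
      (Complex.continuous_ofReal.comp φ.continuous) ?_
    exact hφc.comp_left Complex.ofReal_zero
  have ha : ∀ n, ∫ t, a n t * D t ∂μ = 0 := by
    intro n
    refine h _ ?_ ?_
    · exact (Complex.continuous_ofReal.comp (NNReal.continuous_coe.comp
        (hK.isClosed.apprSeq n).continuous)).mul (Complex.continuous_ofReal.comp φ.continuous)
    · exact (hφc.comp_left Complex.ofReal_zero).mul_left
  have hlim : Filter.Tendsto (fun n => ∫ t, a n t * D t ∂μ) Filter.atTop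
      (nhds (∫ t, K.indicator D t ∂μ)) := by
    refine tendsto_integral_of_dominated_convergence (fun t => ‖(φ t : ℂ) * D t‖) ?_ hφi.norm ?_ ?_
    · intro n
      simp only [a, mul_assoc]
      exact (Complex.continuous_ofReal.comp (NNReal.continuous_coe.comp
        (hK.isClosed.apprSeq n).continuous)).aestronglyMeasurable.mul hφi.aestronglyMeasurable
    · intro n
      refine Filter.Eventually.of_forall fun t => ?_
      simp only [a, mul_assoc]
      rw [norm_mul]
      refine mul_le_of_le_one_left (norm_nonneg _) ?_
      rw [Complex.norm_real, NNReal.norm_eq]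
      exact_mod_cast HasOuterApproxClosed.apprSeq_apply_le_one hK.isClosed n t
    · refine Filter.Eventually.of_forall fun t => ?_
      have h1 := tendsto_pi_nhds.1 (HasOuterApproxClosed.tendsto_apprSeq hK.isClosed) t
      have h2 := ((Complex.continuous_ofReal.comp NNReal.continuous_coe).tendsto _).comp h1
      have h3 := (h2.mul_const (φ t : ℂ)).mul_const (D t)
      have h4 : K.indicator D t = (Complex.ofReal ∘ NNReal.toReal)
          (K.indicator (fun _ => 1) t) * (φ t : ℂ) * D t := by
        by_cases ht : t ∈ K
        · simp [ht, hφ1 ht]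
        · simp [ht]
      rw [h4]
      exact h3
  simp only [ha] at hlim
  rw [← integral_indicator hK.measurableSet]
  exact tendsto_nhds_unique hlim tendsto_const_nhds

/-- The regular representation of the group on `L²`. -/
def regularRepresentation (μ : Measure G) [μ.IsHaarMeasure] :
    G →* (Lp ℂ 2 μ →L[ℂ] Lp ℂ 2 μ) where
  toFun x := LinearMap.mkContinuous
    { toFun := fun u => lpTranslate x u
      map_add' := fun u v => smul_add _ u v
      map_smul' := fun c u => smul_comm _ c u } 1 (fun u => by
        rw [one_mul]; exact (norm_lpTranslate x u).le)
  map_one' := by ext1 u; exact (congrArg (fun y : G => DomMulAct.mk y • u) inv_one).trans (one_smul _ u)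
  map_mul' x y := by ext1 u; exact lpTranslate_mul x y u

instance : Fact ((2 : ENNReal) ≠ ⊤) := ⟨ENNReal.ofNat_ne_top⟩

/-- The operator of convolution with an integrable function on `L²`. -/
def convOp (μ : Measure G) [μ.IsHaarMeasure] : Lp ℂ 1 μ →L[ℂ] (Lp ℂ 2 μ →L[ℂ] Lp ℂ 2 μ) :=
  integratedForm (regularRepresentation μ) (fun x u => norm_lpTranslate x u)
    (fun u => continuous_lpTranslate u)

/-- The convolution of two functions on a group. -/
def groupConv (μ : Measure G) (g h : G → ℂ) (t : G) : ℂ := ∫ x, g x * h (x⁻¹ * t) ∂μ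

theorem exists_norm_le_of_hasCompactSupport {X : Type*} [TopologicalSpace X] {h : X → ℂ}
    (hh : Continuous h) (hs : HasCompactSupport h) : ∃ C, ∀ t, ‖h t‖ ≤ C := by
  obtain ⟨C, hC⟩ := hs.exists_bound_of_continuous hh
  exact ⟨C, hC⟩

theorem continuous_groupConv {g h : G → ℂ} (hg : Integrable g μ) (hh : Continuous h)
    (hs : HasCompactSupport h) : Continuous (groupConv μ g h) := by
  obtain ⟨C, hC⟩ := exists_norm_le_of_hasCompactSupport hh hs
  refine continuous_of_dominated (bound := fun x => ‖g x‖ * C) ?_ ?_ (hg.norm.mul_const C) ?_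
  · intro t
    exact hg.aestronglyMeasurable.mul (by fun_prop)
  · intro t
    refine Filter.Eventually.of_forall fun x => ?_
    rw [norm_mul]
    exact mul_le_mul_of_nonneg_left (hC _) (norm_nonneg _)
  · exact Filter.Eventually.of_forall fun x => by fun_prop

theorem inner_convOp_toLp (g : Lp ℂ 1 μ) {h k : G → ℂ} (hh : Continuous h)
    (hhs : HasCompactSupport h) (hk : Continuous k) (hks : HasCompactSupport k) :
    inner ℂ ((hk.memLp_of_hasCompactSupport hks).toLp k)
      (convOp μ g ((hh.memLp_of_hasCompactSupport hhs).toLp h)) =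
    ∫ t, star (k t) * groupConv μ g h t ∂μ := by
  obtain ⟨C, hC⟩ := exists_norm_le_of_hasCompactSupport hh hhs
  set k₂ : Lp ℂ 2 μ := (hk.memLp_of_hasCompactSupport hks).toLp k
  set h₂ : Lp ℂ 2 μ := (hh.memLp_of_hasCompactSupport hhs).toLp h
  have h1 : inner ℂ k₂ (convOp μ g h₂) = ∫ x, g x * inner ℂ k₂ (lpTranslate x h₂) ∂μ := by
    have := (innerSL ℂ k₂).integral_comp_comm (integrable_smul_representation
      (regularRepresentation μ) (fun x u => norm_lpTranslate x u)
      (fun u => continuous_lpTranslate u) (L1.integrable_coeFn g) h₂)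
    simp only [innerSL_apply_apply, inner_smul_right] at this
    exact this.symm
  have h2 : ∀ x, inner ℂ k₂ (lpTranslate x h₂) = ∫ t, star (k t) * h (x⁻¹ * t) ∂μ := by
    intro x
    rw [L2.inner_def]
    refine integral_congr_ae ?_
    have h3 : (fun t => h₂ (x⁻¹ * t)) =ᵐ[μ] fun t => h (x⁻¹ * t) :=
      (measurePreserving_mul_left μ x⁻¹).quasiMeasurePreserving.ae_eq_comp (MemLp.coeFn_toLp _)
    filter_upwards [coeFn_lpTranslate x h₂, MemLp.coeFn_toLp
      (hk.memLp_of_hasCompactSupport (μ := μ) (p := 2) hks), h3] with t ht1 ht2 ht3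
    rw [ht1, ht3, ht2, RCLike.inner_apply, mul_comm, RCLike.star_def]
  have hki : Integrable (fun t => star (k t)) μ :=
    (hk.star).integrable_of_hasCompactSupport (hks.comp_left (star_zero ℂ))
  have hprod : Integrable (fun z : G × G => (g z.1 * star (k z.2)) * h (z.1⁻¹ * z.2))
      (μ.prod μ) :=
    ((L1.integrable_coeFn g).mul_prod hki).mul_bdd (c := C)
      (Continuous.aestronglyMeasurable (by fun_prop)) (Filter.Eventually.of_forall fun z => hC _)
  rw [h1]
  simp only [h2, ← integral_const_mul, groupConv]
  rw [integral_integral_swap]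
  · congr 1; ext t; congr 1; ext x; ring
  · refine hprod.congr (Filter.Eventually.of_forall fun z => ?_)
    simp only [Function.uncurry]; ring

theorem convOp_toLp_ae_eq (g : Lp ℂ 1 μ) {h : G → ℂ} (hh : Continuous h)
    (hhs : HasCompactSupport h) :
    convOp μ g ((hh.memLp_of_hasCompactSupport hhs).toLp h) =ᵐ[μ] groupConv μ g h := by
  set W := convOp μ g ((hh.memLp_of_hasCompactSupport hhs).toLp h)
  have hW : LocallyIntegrable W μ := (Lp.memLp W).locallyIntegrable (by norm_num)
  have hV : LocallyIntegrable (groupConv μ g h) μ :=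
    (continuous_groupConv (L1.integrable_coeFn g) hh hhs).locallyIntegrable
  rw [← sub_ae_eq_zero]
  refine ae_eq_zero_of_forall_integral_compactlySupported (hW.sub hV) fun k hk hks => ?_
  have hi : ∀ {D : G → ℂ}, LocallyIntegrable D μ → Integrable (fun t => k t * D t) μ :=
    fun hD => hD.integrable_smul_left_of_hasCompactSupport hk hks
  simp only [Pi.sub_apply, mul_sub]
  rw [integral_sub (hi hW) (hi hV), sub_eq_zero]
  have hk' : Continuous fun t => star (k t) := hk.star
  have hks' : HasCompactSupport fun t => star (k t) := hks.comp_left (star_zero ℂ)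
  have := inner_convOp_toLp g hh hhs hk' hks'
  simp only [star_star] at this
  rw [← this, L2.inner_def]
  refine integral_congr_ae ?_
  filter_upwards [MemLp.coeFn_toLp (hk'.memLp_of_hasCompactSupport (μ := μ) (p := 2) hks')]
    with t ht
  rw [ht, RCLike.inner_apply, mul_comm, RCLike.star_def, Complex.conj_conj]

theorem groupConv_comm (g h : G → ℂ) (t : G) : groupConv μ g h t = groupConv μ h g t := by
  rw [groupConv, ← integral_div_left_eq_self _ μ t, groupConv]
  congr 1
  ext x
  rw [mul_comm]
  congr 2
  · simp
  · rw [div_eq_mul_inv, mul_comm]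

/-- Because χ(x) = χ(t) conj χ(x⁻¹t), a character can be moved from one factor to the other. -/
theorem groupConv_mul_character (χ : PontryaginDual G) (g h : G → ℂ) (t : G) :
    groupConv μ (fun s => (χ s : ℂ) * g s) h t =
      (χ t : ℂ) * groupConv μ g (fun s => star (χ s : ℂ) * h s) t := by
  rw [groupConv, groupConv, ← integral_const_mul]
  congr 1
  ext x
  have : (χ x : ℂ) = χ t * star (χ (x⁻¹ * t) : ℂ) := by
    rw [RCLike.star_def, ← Circle.coe_inv_eq_conj, ← Circle.coe_mul, ← map_inv, ← map_mul]
    congr 2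
    simp
  rw [this]; ring

/-- Since (χh) ∗ f = χ · (χ̄f ∗ h), the two convolved vectors differ only by the factor χ, which
leaves χ̄(x) in the correlation. This is the link between the spectral measures of f and of h. -/
theorem inner_convOp_translate_mul_character {f h : G → ℂ} (hf : Continuous f)
    (hfs : HasCompactSupport f) (hh : Continuous h) (hhs : HasCompactSupport h)
    (χ : PontryaginDual G) (a b : Lp ℂ 1 μ) (ha : a =ᵐ[μ] fun t => (χ t : ℂ) * h t)
    (hb : b =ᵐ[μ] fun t => star (χ t : ℂ) * f t) (x : G) :
    inner ℂ (convOp μ a ((hf.memLp_of_hasCompactSupport hfs).toLp f))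
      (lpTranslate x (convOp μ a ((hf.memLp_of_hasCompactSupport hfs).toLp f))) =
    star (χ x : ℂ) * inner ℂ (convOp μ b ((hh.memLp_of_hasCompactSupport hhs).toLp h))
      (lpTranslate x (convOp μ b ((hh.memLp_of_hasCompactSupport hhs).toLp h))) := by
  have hcongr : ∀ {u v w : G → ℂ}, u =ᵐ[μ] v → groupConv μ u w = groupConv μ v w := by
    intro u v w huv
    ext t
    exact integral_congr_ae (by filter_upwards [huv] with s hs; rw [hs])
  have hval : ∀ (g : Lp ℂ 1 μ) {h : G → ℂ} (hh : Continuous h) (hhs : HasCompactSupport h),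
      inner ℂ (convOp μ g ((hh.memLp_of_hasCompactSupport hhs).toLp h))
      (lpTranslate x (convOp μ g ((hh.memLp_of_hasCompactSupport hhs).toLp h))) =
      ∫ t, groupConv μ g h (x⁻¹ * t) * star (groupConv μ g h t) ∂μ := by
    intro g h hh hhs
    rw [L2.inner_def]
    refine integral_congr_ae ?_
    have h1 := convOp_toLp_ae_eq g hh hhs
    filter_upwards [coeFn_lpTranslate x (convOp μ g ((hh.memLp_of_hasCompactSupport hhs).toLp h)),
      h1, (measurePreserving_mul_left μ x⁻¹).quasiMeasurePreserving.ae_eq_comp h1] with t h2 h3 h4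
    simp only [Function.comp_apply] at h4
    rw [h2, h4, h3, RCLike.inner_apply, RCLike.star_def]
  rw [hval a hf hfs, hval b hh hhs, hcongr ha, hcongr hb, ← integral_const_mul]
  congr 1
  ext t
  rw [groupConv_mul_character, groupConv_mul_character, groupConv_comm h, groupConv_comm h, map_mul,
    Circle.coe_mul, map_inv, Circle.coe_inv_eq_conj, star_mul', RCLike.star_def]
  have : (χ t : ℂ) * (starRingEnd ℂ) (χ t : ℂ) = 1 := by
    rw [Complex.mul_conj, Circle.normSq_coe, Complex.ofReal_one]
  linear_combination (starRingEnd ℂ) (χ x : ℂ) *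
    groupConv μ (fun s => (starRingEnd ℂ) (χ s : ℂ) * f s) h (x⁻¹ * t) *
    (starRingEnd ℂ) (groupConv μ (fun s => (starRingEnd ℂ) (χ s : ℂ) * f s) h t) * this
end Regular

/-! ### Comparing spectral measures on the dual group -/

section Dual

set_option linter.unusedSectionVars false

variable {G : Type*} [CommGroup G] [TopologicalSpace G] [IsTopologicalGroup G]
  [LocallyCompactSpace G] [T2Space G] [SecondCountableTopology G]
  [MeasurableSpace G] [BorelSpace G] {μ : Measure G} [μ.IsHaarMeasure]
  [MeasurableSpace (PontryaginDual G)] [BorelSpace (PontryaginDual G)]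

instance : PolishSpace (PontryaginDual G) := by
  let _ : UniformSpace (PontryaginDual G) := IsTopologicalGroup.rightUniformSpace _
  have : IsUniformGroup (PontryaginDual G) := isUniformGroup_of_commGroup
  have : (uniformity (PontryaginDual G)).IsCountablyGenerated :=
    IsUniformGroup.uniformity_countably_generated
  have : CompleteSpace (PontryaginDual G) :=
    IsRightUniformGroup.completeSpace_of_weaklyLocallyCompactSpace
  have : TopologicalSpace.IsCompletelyMetrizableSpace (PontryaginDual G) := inferInstance
  infer_instance

-- The functions ω ↦ conj ω(x) are closed under products and conjugation and separate points, so
-- their span is a star subalgebra large enough to determine a finite measure on a Polish space.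
open BoundedContinuousFunction in
theorem dual_measure_ext {m₁ m₂ : Measure (PontryaginDual G)} [IsFiniteMeasure m₁]
    [IsFiniteMeasure m₂]
    (h : ∀ x : G, ∫ ω, star (ω x : ℂ) ∂m₁ = ∫ ω, star (ω x : ℂ) ∂m₂) : m₁ = m₂ := by
  let e : G → (PontryaginDual G →ᵇ ℂ) := fun x =>
    BoundedContinuousFunction.ofNormedAddCommGroup (fun ω : PontryaginDual G => star (ω x : ℂ))
      (continuous_star.comp (continuous_dual_coe.comp (continuous_id.prodMk continuous_const))) 1
      (fun ω => by rw [norm_star, Circle.norm_coe])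
  have he : ∀ x ω, e x ω = star (ω x : ℂ) := fun x ω => rfl
  let M : Submonoid (PontryaginDual G →ᵇ ℂ) :=
    { carrier := Set.range e
      one_mem' := ⟨1, by ext ω; simp [he]⟩
      mul_mem' := by
        rintro _ _ ⟨x, rfl⟩ ⟨y, rfl⟩
        exact ⟨x * y, by ext ω; simp [he]⟩ }
  have hstar : ∀ a ∈ M, star a ∈ M := by
    rintro _ ⟨x, rfl⟩
    refine ⟨x⁻¹, ?_⟩
    ext ω
    rw [BoundedContinuousFunction.star_apply, he, he, map_inv, Circle.coe_inv_eq_conj, ← RCLike.star_def]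
  refine ext_of_forall_mem_subalgebra_integral_eq_of_polish
    (A := StarAlgebra.adjoin ℂ (M : Set (PontryaginDual G →ᵇ ℂ))) ?_ ?_
  · intro ω₁ ω₂ hne
    obtain ⟨x, hx⟩ : ∃ x, ω₁ x ≠ ω₂ x := by
      by_contra! hc
      exact hne (PontryaginDual.ext hc)
    refine ⟨_, ⟨_, ⟨e x, StarAlgebra.subset_adjoin ℂ _ ⟨x, rfl⟩, rfl⟩, rfl⟩, ?_⟩
    change star (ω₁ x : ℂ) ≠ star (ω₂ x : ℂ)
    intro hc
    exact hx (Circle.ext (star_injective hc))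
  · intro a ha
    have ha' : a ∈ Submodule.span ℂ (M : Set (PontryaginDual G →ᵇ ℂ)) := by
      have h1 := StarAlgebra.adjoin_eq_span (R := ℂ) (M : Set (PontryaginDual G →ᵇ ℂ))
      have h2 : (M : Set (PontryaginDual G →ᵇ ℂ)) ∪ star (M : Set _) = M := by
        refine Set.union_eq_left.2 fun b hb => ?_
        have := hstar _ hb
        rwa [star_star] at this
      rw [h2, Submonoid.closure_eq] at h1
      rw [← h1]
      exact ha
    clear ha
    induction ha' using Submodule.span_induction with
    | mem b hb =>
      obtain ⟨x, rfl⟩ := hb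
      exact h x
    | zero => simp
    | add b c _ _ hb hc =>
      simp only [BoundedContinuousFunction.coe_add, Pi.add_apply]
      rw [integral_add (b.integrable _) (c.integrable _),
        integral_add (b.integrable _) (c.integrable _)]
      rw [hb, hc]
    | smul z b _ hb =>
      simp only [BoundedContinuousFunction.coe_smul]
      rw [integral_smul, integral_smul, hb]

omit [MeasurableSpace (PontryaginDual G)] [BorelSpace (PontryaginDual G)] in
theorem groupFourier_congr {g h : G → ℂ} (hgh : g =ᵐ[μ] h) :
    groupFourier μ g = groupFourier μ h := by
  ext ω
  exact integral_congr_ae (by filter_upwards [hgh] with t ht; rw [ht])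

omit [MeasurableSpace (PontryaginDual G)] [BorelSpace (PontryaginDual G)] in
theorem norm_groupFourier_le (g : G → ℂ) (ω : PontryaginDual G) :
    ‖groupFourier μ g ω‖ ≤ ∫ t, ‖g t‖ ∂μ := by
  refine (norm_integral_le_integral_norm _).trans_eq ?_
  simp only [norm_mul, norm_star, Circle.norm_coe, mul_one]

omit [MeasurableSpace (PontryaginDual G)] [BorelSpace (PontryaginDual G)] in
theorem groupFourier_inv_mul (g : G → ℂ) (χ ω : PontryaginDual G) :
    groupFourier μ g (χ⁻¹ * ω) = groupFourier μ (fun t => (χ t : ℂ) * g t) ω := by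
  refine integral_congr_ae (Filter.Eventually.of_forall fun t => ?_)
  change g t * star (((χ t)⁻¹ * ω t : Circle) : ℂ) = _
  rw [Circle.coe_mul, Circle.coe_inv_eq_conj, star_mul', RCLike.star_def, Complex.conj_conj]
  ring

omit [MeasurableSpace (PontryaginDual G)] [BorelSpace (PontryaginDual G)] in
theorem groupFourier_mul (g : G → ℂ) (χ ω : PontryaginDual G) :
    groupFourier μ g (χ * ω) = groupFourier μ (fun t => star (χ t : ℂ) * g t) ω := by
  refine integral_congr_ae (Filter.Eventually.of_forall fun t => ?_)
  change g t * star ((χ t * ω t : Circle) : ℂ) = _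
  rw [Circle.coe_mul, star_mul']
  ring

/-- The density `|ĝ|²`. -/
def fourierDensity (μ : Measure G) (g : G → ℂ) (ω : PontryaginDual G) : NNReal :=
  ‖groupFourier μ g ω‖₊ ^ 2

theorem continuous_fourierDensity {g : G → ℂ} (hg : Integrable g μ) :
    Continuous (fourierDensity μ g) := (continuous_groupFourier hg).nnnorm.pow 2

theorem fourierDensity_le (g : G → ℂ) (ω : PontryaginDual G) :
    fourierDensity μ g ω ≤ (∫ t, ‖g t‖ ∂μ).toNNReal ^ 2 := by
  refine pow_le_pow_left' ?_ 2
  rw [← NNReal.coe_le_coe, coe_nnnorm]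
  exact (norm_groupFourier_le g ω).trans (Real.le_coe_toNNReal _)

theorem isFiniteMeasure_withDensity_of_le {X : Type*} [MeasurableSpace X] {m : Measure X}
    [IsFiniteMeasure m] {d : X → NNReal} {C : NNReal} (h : ∀ x, d x ≤ C) :
    IsFiniteMeasure (m.withDensity fun x => (d x : ENNReal)) := by
  refine isFiniteMeasure_withDensity ?_
  refine ne_top_of_le_ne_top ?_ (lintegral_mono (g := fun _ => (C : ENNReal)) fun x => ?_)
  · rw [lintegral_const]; exact ENNReal.mul_ne_top ENNReal.coe_ne_top (measure_ne_top _ _)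
  · exact ENNReal.coe_le_coe.2 (h x)

/-- `m` is a spectral measure of the vector `v` of the regular representation, tested on the
range of the convolution operators. -/
def IsSpectralMeasure (μ : Measure G) [μ.IsHaarMeasure] (v : Lp ℂ 2 μ)
    (m : Measure (PontryaginDual G)) : Prop :=
  ∀ (x : G) (g : Lp ℂ 1 μ), inner ℂ (convOp μ g v) (lpTranslate x (convOp μ g v)) =
    ∫ ω, star (ω x : ℂ) * (‖groupFourier μ g ω‖ : ℂ) ^ 2 ∂m

/-- Both sides have the same Fourier coefficients. Multiplying h by χ, or f by χ̄, translates its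
Fourier transform, and the leftover factor χ(x) is absorbed by pushing forward along ω ↦ χ⁻¹ω. -/
theorem spectralMeasure_commutation {f h : G → ℂ} (hf : Continuous f)
    (hfs : HasCompactSupport f) (hh : Continuous h) (hhs : HasCompactSupport h)
    {mf mh : Measure (PontryaginDual G)} [IsFiniteMeasure mf] [IsFiniteMeasure mh]
    (hmf : IsSpectralMeasure μ ((hf.memLp_of_hasCompactSupport hfs).toLp f) mf)
    (hmh : IsSpectralMeasure μ ((hh.memLp_of_hasCompactSupport hhs).toLp h) mh)
    (χ : PontryaginDual G) :
    (mf.withDensity fun ω => (fourierDensity μ h (χ⁻¹ * ω) : ENNReal)).map (fun ω => χ⁻¹ * ω) =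
      mh.withDensity fun ω => (fourierDensity μ f (χ * ω) : ENNReal) := by
  have hχ : Continuous fun t : G => (χ t : ℂ) :=
    continuous_dual_coe.comp (continuous_const.prodMk continuous_id)
  have hfi : Integrable f μ := hf.integrable_of_hasCompactSupport hfs
  have hhi : Integrable h μ := hh.integrable_of_hasCompactSupport hhs
  let a : G → ℂ := fun t => (χ t : ℂ) * h t
  let b : G → ℂ := fun t => star (χ t : ℂ) * f t
  have ha1 : MemLp a 1 μ := (hχ.mul hh).memLp_of_hasCompactSupport hhs.mul_left
  have hb1 : MemLp b 1 μ := (hχ.star.mul hf).memLp_of_hasCompactSupport hfs.mul_left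
  have hAf := groupFourier_congr ha1.coeFn_toLp
  have hBf := groupFourier_congr hb1.coeFn_toLp
  have := isFiniteMeasure_withDensity_of_le (m := mf)
    (fun ω => fourierDensity_le (μ := μ) h (χ⁻¹ * ω))
  have := isFiniteMeasure_withDensity_of_le (m := mh)
    (fun ω => fourierDensity_le (μ := μ) f (χ * ω))
  have hmeas : Measurable fun ω : PontryaginDual G => χ⁻¹ * ω := measurable_const_mul _
  have hχ1 : ∀ x, (χ x : ℂ) * star (χ x : ℂ) = 1 := fun x => by
    rw [RCLike.star_def, Complex.mul_conj, Circle.normSq_coe, Complex.ofReal_one]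
  refine dual_measure_ext fun x => ?_
  have hcs : Continuous fun ω : PontryaginDual G => star (ω x : ℂ) :=
    continuous_star.comp (continuous_dual_coe.comp (continuous_id.prodMk continuous_const))
  have hd1 : Measurable fun ω => fourierDensity μ h (χ⁻¹ * ω) :=
    ((continuous_fourierDensity hhi).comp (continuous_const_mul χ⁻¹)).measurable
  have hd2 : Measurable fun ω => fourierDensity μ f (χ * ω) :=
    ((continuous_fourierDensity hfi).comp (continuous_const_mul χ)).measurable
  rw [integral_map hmeas.aemeasurable hcs.aestronglyMeasurable,
    integral_withDensity_eq_integral_smul hd1, integral_withDensity_eq_integral_smul hd2]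
  have h1 := hmf x (ha1.toLp a)
  have h2 := hmh x (hb1.toLp b)
  rw [hAf] at h1
  rw [hBf] at h2
  rw [inner_convOp_translate_mul_character hf hfs hh hhs χ _ _ ha1.coeFn_toLp hb1.coeFn_toLp x,
    h2] at h1
  have h3 := congrArg (fun z => (χ x : ℂ) * z) h1
  simp only [← mul_assoc, hχ1, one_mul] at h3
  rw [← integral_const_mul] at h3
  calc _ = ∫ ω, (χ x : ℂ) * (star (ω x : ℂ) * (‖groupFourier μ a ω‖ : ℂ) ^ 2) ∂mf := by
        refine integral_congr_ae (Filter.Eventually.of_forall fun ω => ?_)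
        change fourierDensity μ h (χ⁻¹ * ω) • star (((χ x)⁻¹ * ω x : Circle) : ℂ) = _
        rw [fourierDensity, groupFourier_inv_mul, Circle.coe_mul, Circle.coe_inv_eq_conj,
          star_mul', RCLike.star_def, Complex.conj_conj, NNReal.smul_def, Complex.real_smul]
        push_cast
        ring
    _ = _ := by
        rw [← h3]
        refine integral_congr_ae (Filter.Eventually.of_forall fun ω => ?_)
        simp only
        rw [fourierDensity, groupFourier_mul, NNReal.smul_def, Complex.real_smul]
        push_cast
        ring

end Dual

/-- Integrate the hypothesis over χ and apply Tonelli. Invariance of ν under translation and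
inversion makes each inner integral independent of the shift. -/
theorem lintegral_mul_eq_of_forall_translate {Γ : Type*} [CommGroup Γ] [MeasurableSpace Γ]
    [MeasurableMul₂ Γ] [MeasurableInv Γ] (ν : Measure Γ) [SFinite ν] [ν.IsMulLeftInvariant]
    [ν.IsInvInvariant] {m₁ m₂ : Measure Γ} [SFinite m₁] [SFinite m₂] {d₁ d₂ P : Γ → ENNReal}
    (h₁ : Measurable d₁) (h₂ : Measurable d₂) (hP : Measurable P)
    (h : ∀ χ, ∫⁻ ω, d₂ (χ⁻¹ * ω) * P (χ⁻¹ * ω) ∂m₁ = ∫⁻ ω, d₁ (χ * ω) * P ω ∂m₂) :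
    m₁ Set.univ * ∫⁻ ω, d₂ ω * P ω ∂ν = (∫⁻ ω, d₁ ω ∂ν) * ∫⁻ ω, P ω ∂m₂ := by
  have hint : ∫⁻ χ, ∫⁻ ω, d₂ (χ⁻¹ * ω) * P (χ⁻¹ * ω) ∂m₁ ∂ν =
      ∫⁻ χ, ∫⁻ ω, d₁ (χ * ω) * P ω ∂m₂ ∂ν := lintegral_congr h
  have hQ : Measurable fun χ => d₂ χ * P χ := h₂.mul hP
  have h5 : Measurable fun z : Γ × Γ => z.1⁻¹ * z.2 := measurable_fst.inv.mul measurable_snd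
  have h6 : Measurable fun z : Γ × Γ => z.1 * z.2 := measurable_fst.mul measurable_snd
  have h3 : ∀ ω : Γ, ∫⁻ χ, d₂ (χ⁻¹ * ω) * P (χ⁻¹ * ω) ∂ν = ∫⁻ χ, d₂ χ * P χ ∂ν := by
    intro ω
    rw [← (Measure.measurePreserving_div_left ν ω).lintegral_comp hQ]
    refine lintegral_congr fun χ => ?_
    rw [div_eq_mul_inv, mul_comm ω]
  have h4 : ∀ ω : Γ, ∫⁻ χ, d₁ (χ * ω) * P ω ∂ν = (∫⁻ χ, d₁ χ ∂ν) * P ω := by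
    intro ω
    have hm : Measurable fun χ => d₁ (χ * ω) := h₁.comp (measurable_mul_const _)
    rw [lintegral_mul_const _ hm, lintegral_mul_right_eq_self d₁]
  have hL : ∫⁻ χ, ∫⁻ ω, d₂ (χ⁻¹ * ω) * P (χ⁻¹ * ω) ∂m₁ ∂ν =
      m₁ Set.univ * ∫⁻ ω, d₂ ω * P ω ∂ν := by
    have hm : AEMeasurable (Function.uncurry fun χ ω => d₂ (χ⁻¹ * ω) * P (χ⁻¹ * ω))
        (ν.prod m₁) := (hQ.comp h5).aemeasurable
    rw [lintegral_lintegral_swap hm, lintegral_congr h3, lintegral_const,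
      mul_comm]
  have hR : ∫⁻ χ, ∫⁻ ω, d₁ (χ * ω) * P ω ∂m₂ ∂ν = (∫⁻ ω, d₁ ω ∂ν) * ∫⁻ ω, P ω ∂m₂ := by
    have hm : AEMeasurable (Function.uncurry fun χ ω => d₁ (χ * ω) * P ω) (ν.prod m₂) :=
      ((h₁.comp h6).mul (hP.comp measurable_snd)).aemeasurable
    rw [lintegral_lintegral_swap hm,
      lintegral_congr h4, lintegral_const_mul _ hP]
  rw [← hL, hint, hR]

/-! ### Plancherel and Parseval -/

section Parseval

set_option linter.unusedSectionVars false

variable {G : Type*} [CommGroup G] [TopologicalSpace G] [IsTopologicalGroup G]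
  [LocallyCompactSpace G] [T2Space G] [SecondCountableTopology G]
  [MeasurableSpace G] [BorelSpace G] {μ : Measure G} [μ.IsHaarMeasure]
  [MeasurableSpace (PontryaginDual G)] [BorelSpace (PontryaginDual G)]
  (ν : Measure (PontryaginDual G)) [ν.IsHaarMeasure]

theorem spectralMeasure_lintegral {f h : G → ℂ} (hf : Continuous f)
    (hfs : HasCompactSupport f) (hh : Continuous h) (hhs : HasCompactSupport h)
    {mf mh : Measure (PontryaginDual G)} [IsFiniteMeasure mf] [IsFiniteMeasure mh]
    (hmf : IsSpectralMeasure μ ((hf.memLp_of_hasCompactSupport hfs).toLp f) mf)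
    (hmh : IsSpectralMeasure μ ((hh.memLp_of_hasCompactSupport hhs).toLp h) mh)
    {P : PontryaginDual G → ENNReal} (hP : Measurable P) :
    mf Set.univ * ∫⁻ ω, fourierDensity μ h ω * P ω ∂ν =
      (∫⁻ ω, fourierDensity μ f ω ∂ν) * ∫⁻ ω, P ω ∂mh := by
  have hdf : Measurable fun ω => (fourierDensity μ f ω : ENNReal) :=
    (continuous_fourierDensity (hf.integrable_of_hasCompactSupport hfs)).measurable.coe_nnreal_ennreal
  have hdh : Measurable fun ω => (fourierDensity μ h ω : ENNReal) :=
    (continuous_fourierDensity (hh.integrable_of_hasCompactSupport hhs)).measurable.coe_nnreal_ennreal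
  have hkey : ∀ χ : PontryaginDual G,
      ∫⁻ ω, fourierDensity μ h (χ⁻¹ * ω) * P (χ⁻¹ * ω) ∂mf =
        ∫⁻ ω, fourierDensity μ f (χ * ω) * P ω ∂mh := by
    intro χ
    have h1 := congrArg (fun m => ∫⁻ ω, P ω ∂m)
      (spectralMeasure_commutation hf hfs hh hhs hmf hmh χ)
    have hP' : Measurable fun ω => P (χ⁻¹ * ω) := hP.comp (measurable_const_mul _)
    have hdh' : Measurable fun ω => (fourierDensity μ h (χ⁻¹ * ω) : ENNReal) :=
      hdh.comp (measurable_const_mul _)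
    have hdf' : Measurable fun ω => (fourierDensity μ f (χ * ω) : ENNReal) :=
      hdf.comp (measurable_const_mul _)
    rw [lintegral_map hP (measurable_const_mul _),
      lintegral_withDensity_eq_lintegral_mul _ hdh' hP',
      lintegral_withDensity_eq_lintegral_mul _ hdf' hP] at h1
    exact h1
  exact lintegral_mul_eq_of_forall_translate ν hdf hdh hP hkey

theorem exists_isSpectralMeasure (v : Lp ℂ 2 μ) :
    ∃ m : Measure (PontryaginDual G), IsFiniteMeasure m ∧ IsSpectralMeasure μ v m ∧
      ∀ g : Lp ℂ 1 μ, inner ℂ v (convOp μ g v) = ∫ ω, groupFourier μ g ω ∂m := by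
  obtain ⟨m, hm, h1, h2⟩ := exists_spectral_measure (μ := μ) (regularRepresentation μ)
    (fun x u => norm_lpTranslate x u) (fun u => continuous_lpTranslate u) v
  exact ⟨m, hm, h2, h1⟩

variable (μ) in
/-- The Plancherel theorem: the spectral measure of a continuous compactly supported function is
a fixed multiple of `|ĥ|² ν`. -/
theorem exists_spectralMeasure_eq :
    ∃ c : ENNReal, c ≠ ⊤ ∧ ∀ (h : G → ℂ) (hh : Continuous h) (hhs : HasCompactSupport h)
      (m : Measure (PontryaginDual G)) [IsFiniteMeasure m],
      IsSpectralMeasure μ ((hh.memLp_of_hasCompactSupport hhs).toLp h) m →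
        m = c • ν.withDensity fun ω => (fourierDensity μ h ω : ENNReal) := by
  obtain ⟨φ, hφ1, -, hφc, hφ01⟩ := exists_continuous_one_zero_of_isCompact
    (isCompact_singleton (x := (1 : G))) isClosed_empty (Set.disjoint_empty _)
  have hφ1' : φ 1 = 1 := hφ1 rfl
  -- A nonzero nonnegative reference function: its Fourier transform at the trivial character is ∫ φ
  -- > 0, which by continuity forces B ≠ 0 below.
  let f : G → ℂ := fun t => (φ t : ℂ)
  have hf : Continuous f := Complex.continuous_ofReal.comp φ.continuous
  have hfs : HasCompactSupport f := hφc.comp_left Complex.ofReal_zero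
  have hfi : Integrable f μ := hf.integrable_of_hasCompactSupport hfs
  obtain ⟨mf, hmfin, hmf, -⟩ :=
    exists_isSpectralMeasure ((hf.memLp_of_hasCompactSupport (μ := μ) (p := 2) hfs).toLp f)
  have hf1 : groupFourier μ f 1 ≠ 0 := by
    have h1 : groupFourier μ f 1 = ((∫ t, φ t ∂μ : ℝ) : ℂ) := by
      rw [← integral_complex_ofReal]
      refine integral_congr_ae (Filter.Eventually.of_forall fun t => ?_)
      change (φ t : ℂ) * star ((1 : Circle) : ℂ) = _
      simp
    rw [h1, Complex.ofReal_ne_zero]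
    exact (φ.continuous.integral_pos_of_hasCompactSupport_nonneg_nonzero hφc
      (fun t => (hφ01 t).1) (x := 1) (by rw [hφ1']; exact one_ne_zero)).ne'
  set B := ∫⁻ ω, fourierDensity μ f ω ∂ν with hB
  have hB0 : B ≠ 0 := by
    intro h0
    have hc := continuous_fourierDensity hfi
    rw [hB, lintegral_eq_zero_iff hc.measurable.coe_nnreal_ennreal] at h0
    have h1 : fourierDensity μ f =ᵐ[ν] fun _ => 0 := by
      filter_upwards [h0] with ω hω
      exact ENNReal.coe_eq_zero.1 hω
    have h2 := congrFun ((hc.ae_eq_iff_eq ν continuous_const).1 h1) 1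
    simp only [fourierDensity, ne_eq, OfNat.ofNat_ne_zero, not_false_eq_true, pow_eq_zero_iff,
      nnnorm_eq_zero] at h2
    exact hf1 h2
  have hset : ∀ (h : G → ℂ) (hh : Continuous h) (hhs : HasCompactSupport h)
      (m : Measure (PontryaginDual G)) [IsFiniteMeasure m],
      IsSpectralMeasure μ ((hh.memLp_of_hasCompactSupport hhs).toLp h) m →
      ∀ s, MeasurableSet s →
        mf Set.univ * ∫⁻ ω in s, fourierDensity μ h ω ∂ν = B * m s := by
    intro h hh hhs m _ hm s hs
    have h1 := spectralMeasure_lintegral ν hf hfs hh hhs hmf hm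
      (P := s.indicator 1) (measurable_one.indicator hs)
    rw [lintegral_indicator_one hs] at h1
    rw [← h1, ← lintegral_indicator hs]
    congr 2
    ext ω
    by_cases hω : ω ∈ s <;> simp [hω]
  -- Finiteness of B need not be proved: if B were infinite, finiteness of the left side of `hset`
  -- on compact sets would force m = 0, and c = 0 serves. No later step needs c ≠ 0.
  by_cases hBt : B = ⊤
  · refine ⟨0, ENNReal.zero_ne_top, fun h hh hhs m _ hm => ?_⟩
    rw [zero_smul, ← Measure.measure_univ_eq_zero, ← iUnion_compactCovering, measure_iUnion_null_iff]
    intro n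
    have hK := isCompact_compactCovering (PontryaginDual G) n
    have h1 := hset h hh hhs m hm _ hK.measurableSet
    by_contra hne
    rw [hBt, ENNReal.top_mul hne] at h1
    refine ENNReal.mul_ne_top (measure_ne_top _ _) ?_ h1
    refine ne_top_of_le_ne_top ?_ (lintegral_mono (g := fun _ =>
      (((∫ t, ‖h t‖ ∂μ).toNNReal ^ 2 : NNReal) : ENNReal)) fun ω =>
        ENNReal.coe_le_coe.2 (fourierDensity_le h ω))
    rw [lintegral_const, Measure.restrict_apply_univ]
    exact ENNReal.mul_ne_top ENNReal.coe_ne_top hK.measure_lt_top.ne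
  · refine ⟨mf Set.univ / B, ENNReal.div_ne_top (measure_ne_top _ _) hB0, ?_⟩
    intro h hh hhs m _ hm
    ext s hs
    rw [Measure.smul_apply, withDensity_apply _ hs, smul_eq_mul, div_eq_mul_inv, mul_right_comm,
      hset h hh hhs m hm s hs, mul_right_comm, ENNReal.mul_inv_cancel hB0 hBt, one_mul]

theorem groupFourier_add_const_mul {h k : G → ℂ} (hh : Integrable h μ) (hk : Integrable k μ)
    (z : ℂ) (ω : PontryaginDual G) :
    groupFourier μ (fun t => h t + z * k t) ω = groupFourier μ h ω + z * groupFourier μ k ω := by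
  have hi : ∀ {g : G → ℂ}, Integrable g μ → Integrable (fun t => g t * star (ω t : ℂ)) μ := by
    intro g hg
    refine hg.mul_bdd (c := 1) ?_ (Filter.Eventually.of_forall fun t => ?_)
    · exact (continuous_star.comp (continuous_dual_coe.comp
        (continuous_const.prodMk continuous_id))).aestronglyMeasurable
    · rw [norm_star, Circle.norm_coe]
  rw [groupFourier, groupFourier, groupFourier, ← integral_const_mul,
    ← integral_add (hi hh) ((hi hk).const_mul z)]
  congr 1
  ext t
  ring

theorem integrable_mul_groupFourier {Φ : PontryaginDual G → ℂ} (hΦ : Integrable Φ ν) {h : G → ℂ}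
    (hh : Integrable h μ) : Integrable (fun ω => Φ ω * groupFourier μ h ω) ν :=
  hΦ.mul_bdd (c := ∫ t, ‖h t‖ ∂μ) (continuous_groupFourier hh).aestronglyMeasurable
    (Filter.Eventually.of_forall fun ω => norm_groupFourier_le h ω)

theorem integrable_mul_star_groupFourier {Φ : PontryaginDual G → ℂ} (hΦ : Integrable Φ ν)
    {h : G → ℂ} (hh : Integrable h μ) :
    Integrable (fun ω => Φ ω * star (groupFourier μ h ω)) ν :=
  hΦ.mul_bdd (c := ∫ t, ‖h t‖ ∂μ) (continuous_groupFourier hh).star.aestronglyMeasurable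
    (Filter.Eventually.of_forall fun ω => by rw [norm_star]; exact norm_groupFourier_le h ω)

theorem star_groupFourier_star (k : G → ℂ) (ω : PontryaginDual G) :
    star (groupFourier μ (fun t => star (k t)) ω) = ∫ t, k t * (ω t : ℂ) ∂μ := by
  rw [RCLike.star_def, groupFourier, ← integral_conj]
  congr 1
  ext t
  simp only [map_mul, RCLike.star_def, Complex.conj_conj]

/-- Polarization: the Parseval identity for the convolution operators follows from its
diagonal case. -/
theorem inner_convOp_eq_of_diagonal (c : ℂ) (φ : Lp ℂ 1 μ)
    (hφ : Integrable (groupFourier μ φ) ν)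
    (hdiag : ∀ (h : G → ℂ) (hh : Continuous h) (hhs : HasCompactSupport h),
      inner ℂ ((hh.memLp_of_hasCompactSupport hhs).toLp h : Lp ℂ 2 μ)
        (convOp μ φ ((hh.memLp_of_hasCompactSupport hhs).toLp h)) =
      c * ∫ ω, groupFourier μ φ ω * groupFourier μ h ω * star (groupFourier μ h ω) ∂ν)
    {h k : G → ℂ} (hh : Continuous h) (hhs : HasCompactSupport h) (hk : Continuous k)
    (hks : HasCompactSupport k) :
    inner ℂ ((hk.memLp_of_hasCompactSupport hks).toLp k : Lp ℂ 2 μ)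
        (convOp μ φ ((hh.memLp_of_hasCompactSupport hhs).toLp h)) =
      c * ∫ ω, groupFourier μ φ ω * groupFourier μ h ω * star (groupFourier μ k ω) ∂ν := by
  have hhi : Integrable h μ := hh.integrable_of_hasCompactSupport hhs
  have hki : Integrable k μ := hk.integrable_of_hasCompactSupport hks
  set h₂ : Lp ℂ 2 μ := (hh.memLp_of_hasCompactSupport hhs).toLp h with hh₂
  set k₂ : Lp ℂ 2 μ := (hk.memLp_of_hasCompactSupport hks).toLp k with hk₂
  -- This is the diagonal identity at h + zk, less those at h and k. The values z = 1 and z = i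
  -- separate the two terms.
  have hz : ∀ z : ℂ,
      z * (inner ℂ h₂ (convOp μ φ k₂) -
        c * ∫ ω, groupFourier μ φ ω * groupFourier μ k ω * star (groupFourier μ h ω) ∂ν) +
      star z * (inner ℂ k₂ (convOp μ φ h₂) -
        c * ∫ ω, groupFourier μ φ ω * groupFourier μ h ω * star (groupFourier μ k ω) ∂ν) = 0 := by
    intro z
    have hc : Continuous fun t => h t + z * k t := hh.add (continuous_const.mul hk)
    have hcs : HasCompactSupport fun t => h t + z * k t := hhs.add hks.mul_left
    have h0 := hdiag _ hc hcs
    have hlp : ((hc.memLp_of_hasCompactSupport hcs).toLp _ : Lp ℂ 2 μ) = h₂ + z • k₂ := by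
      rw [hh₂, hk₂, ← MemLp.toLp_const_smul, ← MemLp.toLp_add]
      rfl
    rw [hlp, map_add, map_smul, inner_add_left, inner_add_right, inner_add_right, inner_smul_left,
      inner_smul_left, inner_smul_right, inner_smul_right, hdiag h hh hhs, hdiag k hk hks] at h0
    have hI : ∀ {u v : G → ℂ}, Integrable u μ → Integrable v μ → Integrable (fun ω =>
        groupFourier μ φ ω * groupFourier μ u ω * star (groupFourier μ v ω)) ν := fun hu hv =>
      integrable_mul_star_groupFourier ν (integrable_mul_groupFourier ν hφ hu) hv
    have hexp : ∫ ω, groupFourier μ φ ω * groupFourier μ (fun t => h t + z * k t) ω *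
          star (groupFourier μ (fun t => h t + z * k t) ω) ∂ν =
        ∫ ω, groupFourier μ φ ω * groupFourier μ h ω * star (groupFourier μ h ω) ∂ν +
        z * ∫ ω, groupFourier μ φ ω * groupFourier μ k ω * star (groupFourier μ h ω) ∂ν +
        (star z * ∫ ω, groupFourier μ φ ω * groupFourier μ h ω * star (groupFourier μ k ω) ∂ν +
        star z * z *
          ∫ ω, groupFourier μ φ ω * groupFourier μ k ω * star (groupFourier μ k ω) ∂ν) := by
      rw [← integral_const_mul, ← integral_const_mul, ← integral_const_mul,
        ← integral_add (hI hhi hhi) ((hI hki hhi).const_mul _),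
        ← integral_add ((hI hhi hki).const_mul _) ((hI hki hki).const_mul _), ← integral_add]
      · congr 1
        ext ω
        rw [groupFourier_add_const_mul hhi hki, star_add, star_mul']
        ring
      · exact (hI hhi hhi).add ((hI hki hhi).const_mul _)
      · exact ((hI hhi hki).const_mul _).add ((hI hki hki).const_mul _)
    rw [hexp] at h0
    rw [← RCLike.star_def] at h0
    linear_combination h0
  have e1 := hz 1
  have e2 := hz Complex.I
  rw [star_one] at e1
  have hstarI : star Complex.I = -Complex.I := Complex.conj_I
  rw [hstarI] at e2
  have e3 : (2 : ℂ) * (inner ℂ k₂ (convOp μ φ h₂) -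
      c * ∫ ω, groupFourier μ φ ω * groupFourier μ h ω * star (groupFourier μ k ω) ∂ν) = 0 := by
    linear_combination e1 + Complex.I * e2 - (inner ℂ h₂ (convOp μ φ k₂) -
        c * ∫ ω, groupFourier μ φ ω * groupFourier μ k ω * star (groupFourier μ h ω) ∂ν -
        (inner ℂ k₂ (convOp μ φ h₂) -
        c * ∫ ω, groupFourier μ φ ω * groupFourier μ h ω * star (groupFourier μ k ω) ∂ν)) *
        Complex.I_mul_I
  exact sub_eq_zero.1 ((mul_eq_zero.1 e3).resolve_left two_ne_zero)

variable (μ) in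
/-- A Parseval formula: for integrable `φ` with integrable Fourier transform and every continuous
compactly supported `m`, `∫ φ m̄ dμ = c ∫ φ̂ conj m̂ dν`. -/
theorem exists_parseval :
    ∃ c : ℂ, ∀ φ : G → ℂ, Integrable φ μ → Integrable (groupFourier μ φ) ν →
      ∀ m : G → ℂ, Continuous m → HasCompactSupport m →
        ∫ t, φ t * star (m t) ∂μ =
          c * ∫ ω, groupFourier μ φ ω * star (groupFourier μ m ω) ∂ν := by
  obtain ⟨c, hc, hspec⟩ := exists_spectralMeasure_eq μ ν
  refine ⟨(c.toReal : ℂ), fun φ hφi hφF m hm hms => ?_⟩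
  let φ₁ : Lp ℂ 1 μ := hφi.toL1 φ
  have hφ₁ : φ₁ =ᵐ[μ] φ := hφi.coeFn_toL1
  have hF₁ : groupFourier μ φ₁ = groupFourier μ φ := groupFourier_congr hφ₁
  have hφF₁ : Integrable (groupFourier μ φ₁) ν := by rw [hF₁]; exact hφF
  have hdiag : ∀ (h : G → ℂ) (hh : Continuous h) (hhs : HasCompactSupport h),
      inner ℂ ((hh.memLp_of_hasCompactSupport hhs).toLp h : Lp ℂ 2 μ)
        (convOp μ φ₁ ((hh.memLp_of_hasCompactSupport hhs).toLp h)) =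
      c.toReal * ∫ ω, groupFourier μ φ₁ ω * groupFourier μ h ω * star (groupFourier μ h ω) ∂ν := by
    intro h hh hhs
    obtain ⟨mh, hfin, hmh, hval⟩ := exists_isSpectralMeasure
      ((hh.memLp_of_hasCompactSupport (μ := μ) (p := 2) hhs).toLp h)
    rw [hval, hspec h hh hhs mh hmh, integral_smul_measure, integral_withDensity_eq_integral_smul
      (continuous_fourierDensity (hh.integrable_of_hasCompactSupport hhs)).measurable,
      Complex.real_smul]
    congr 1
    refine integral_congr_ae (Filter.Eventually.of_forall fun ω => ?_)
    simp only
    rw [fourierDensity, NNReal.smul_def, Complex.real_smul, mul_assoc, RCLike.star_def,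
      Complex.mul_conj']
    push_cast
    ring
  -- Chosen so that (φ ∗ h)(1) = ∫ φ m̄ and ĥ = conj m̂.
  let h : G → ℂ := fun t => star (m t⁻¹)
  have hh : Continuous h := (hm.comp continuous_inv).star
  have hhs : HasCompactSupport h :=
    (hms.comp_homeomorph (Homeomorph.inv G)).comp_left (star_zero ℂ)
  have hhi : Integrable h μ := hh.integrable_of_hasCompactSupport hhs
  have hFh : ∀ ω, groupFourier μ h ω = star (groupFourier μ m ω) := by
    intro ω
    rw [groupFourier, groupFourier, ← integral_inv_eq_self, RCLike.star_def, ← integral_conj]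
    congr 1
    ext t
    simp only [h, inv_inv, map_inv, Circle.coe_inv_eq_conj, map_mul, RCLike.star_def,
      Complex.conj_conj]
  let R : G → ℂ := fun t =>
    c.toReal * ∫ ω, groupFourier μ φ ω * groupFourier μ h ω * (ω t : ℂ) ∂ν
  have hΨ := integrable_mul_groupFourier ν hφF hhi
  have hR : Continuous R := by
    refine continuous_const.mul (continuous_of_dominated
      (bound := fun ω => ‖groupFourier μ φ ω * groupFourier μ h ω‖) ?_ ?_ hΨ.norm ?_)
    · intro t
      exact hΨ.aestronglyMeasurable.mul (continuous_dual_coe.comp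
        (continuous_id.prodMk continuous_const)).aestronglyMeasurable
    · intro t
      refine Filter.Eventually.of_forall fun ω => ?_
      rw [norm_mul, Circle.norm_coe, mul_one]
    · refine Filter.Eventually.of_forall fun ω => continuous_const.mul ?_
      exact continuous_dual_coe.comp (continuous_const.prodMk continuous_id)
  have hconv : Continuous (groupConv μ φ h) := continuous_groupConv hφi hh hhs
  have hconv₁ : groupConv μ φ₁ h = groupConv μ φ h := by
    ext t
    exact integral_congr_ae (by filter_upwards [hφ₁] with x hx; rw [hx])
  -- R is c times the inverse transform of φ̂ ĥ. Equality is tested against compactly supported k;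
  -- continuity of both sides then permits evaluation at 1.
  have hae : groupConv μ φ h =ᵐ[μ] R := by
    rw [← sub_ae_eq_zero]
    refine ae_eq_zero_of_forall_integral_compactlySupported
      (hconv.locallyIntegrable.sub hR.locallyIntegrable) fun k hk hks => ?_
    have hki : Integrable k μ := hk.integrable_of_hasCompactSupport hks
    have hk' : Continuous fun t => star (k t) := hk.star
    have hks' : HasCompactSupport fun t => star (k t) := hks.comp_left (star_zero ℂ)
    have h1 := inner_convOp_eq_of_diagonal ν _ φ₁ hφF₁ hdiag hh hhs hk' hks'
    rw [inner_convOp_toLp φ₁ hh hhs hk' hks', hconv₁, hF₁] at h1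
    simp only [star_star] at h1
    have hi : ∀ {D : G → ℂ}, Continuous D → Integrable (fun t => k t * D t) μ :=
      fun hD => hD.locallyIntegrable.integrable_smul_left_of_hasCompactSupport hk hks
    simp only [Pi.sub_apply, mul_sub]
    rw [integral_sub (hi hconv) (hi hR), h1, sub_eq_zero]
    have h2 : ∀ ω, groupFourier μ φ ω * groupFourier μ h ω *
        star (groupFourier μ (fun t => star (k t)) ω) =
        ∫ t, groupFourier μ φ ω * groupFourier μ h ω * (k t * (ω t : ℂ)) ∂μ := by
      intro ω
      rw [integral_const_mul, star_groupFourier_star]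
    simp only [h2]
    rw [integral_integral_swap]
    · rw [← integral_const_mul]
      congr 1
      ext t
      simp only [R]
      rw [mul_left_comm, ← integral_const_mul (k t)]
      congr 2
      ext ω
      ring
    · have h3 := (hΨ.mul_prod hki).mul_bdd (c := 1) (g := fun z => (z.1 z.2 : ℂ))
        continuous_dual_coe.aestronglyMeasurable
        (Filter.Eventually.of_forall fun z => by rw [Circle.norm_coe])
      refine h3.congr (Filter.Eventually.of_forall fun z => ?_)
      simp only [Function.uncurry]
      ring
  have h1 := congrFun ((hconv.ae_eq_iff_eq μ hR).1 hae) 1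
  have h2 : groupConv μ φ h 1 = ∫ t, φ t * star (m t) ∂μ := by
    rw [groupConv]
    congr 1
    ext x
    simp [h]
  rw [← h2, h1]
  simp only [R, hFh, map_one, Circle.coe_one, mul_one]
end Parseval

/-! ### Reconstruction from the short-time Fourier transform -/

section Feichtinger

set_option linter.unusedSectionVars false

variable {G : Type*} [CommGroup G] [TopologicalSpace G] [IsTopologicalGroup G]
  [LocallyCompactSpace G] [T2Space G] [SecondCountableTopology G]
  [MeasurableSpace G] [BorelSpace G] {μ : Measure G} [μ.IsHaarMeasure]
  [MeasurableSpace (PontryaginDual G)] [BorelSpace (PontryaginDual G)]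
  {ν : Measure (PontryaginDual G)} [ν.IsHaarMeasure]

/-- The short-time Fourier transform of `ξ` with window `ξ`. -/
def autoSTFT (μ : Measure G) (ξ : G → ℂ) (z : G × PontryaginDual G) : ℂ :=
  l2Inner μ ξ (timeFreqShift z ξ)

omit [MeasurableSpace (PontryaginDual G)] [BorelSpace (PontryaginDual G)] in
theorem autoSTFT_eq_groupFourier (ξ : G → ℂ) (x : G) (ω : PontryaginDual G) :
    autoSTFT μ ξ (x, ω) = groupFourier μ (fun t => ξ t * star (ξ (x⁻¹ * t))) ω := by
  refine integral_congr_ae (Filter.Eventually.of_forall fun t => ?_)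
  change ξ t * star ((ω t : ℂ) * ξ (x⁻¹ * t)) = _
  rw [star_mul']
  ring

omit [MeasurableSpace (PontryaginDual G)] [BorelSpace (PontryaginDual G)] in
theorem integrable_mul_star_translate {ξ : G → ℂ} (hξ : MemLp ξ 2 μ) (x : G) :
    Integrable (fun t => ξ t * star (ξ (x⁻¹ * t))) μ := by
  have h1 : MemLp (fun t => star (ξ (x⁻¹ * t))) 2 μ :=
    (hξ.comp_measurePreserving (measurePreserving_mul_left μ x⁻¹)).star
  exact hξ.integrable_mul h1

/-- The synthesis of the short-time Fourier transform `V` with window `h`. -/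
def stftSynthesis (μ : Measure G) (ν : Measure (PontryaginDual G)) (V : G × PontryaginDual G → ℂ)
    (h : G → ℂ) (t : G) : ℂ :=
  ∫ z, V z * ((z.2 t : ℂ) * h (z.1⁻¹ * t)) ∂(μ.prod ν)

theorem continuous_stftSynthesis {V : G × PontryaginDual G → ℂ} (hV : Integrable V (μ.prod ν))
    {h : G → ℂ} (hh : Continuous h) (hhs : HasCompactSupport h) :
    Continuous (stftSynthesis μ ν V h) := by
  obtain ⟨C, hC⟩ := exists_norm_le_of_hasCompactSupport hh hhs
  refine continuous_of_dominated (bound := fun z => ‖V z‖ * C) ?_ ?_ (hV.norm.mul_const C) ?_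
  · intro t
    refine hV.aestronglyMeasurable.mul (Continuous.aestronglyMeasurable ?_)
    refine Continuous.mul ?_ (by fun_prop)
    exact continuous_dual_coe.comp (continuous_snd.prodMk continuous_const)
  · intro t
    refine Filter.Eventually.of_forall fun z => ?_
    rw [norm_mul, norm_mul, Circle.norm_coe, one_mul]
    exact mul_le_mul_of_nonneg_left (hC _) (norm_nonneg _)
  · refine Filter.Eventually.of_forall fun z => continuous_const.mul (Continuous.mul ?_ ?_)
    · exact continuous_dual_coe.comp (continuous_const.prodMk continuous_id)
    · fun_prop

theorem norm_stftSynthesis_le (V : G × PontryaginDual G → ℂ) (h : G → ℂ) (t : G) :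
    ‖stftSynthesis μ ν V h t‖ ≤ ∫ z, ‖V z‖ * ‖h (z.1⁻¹ * t)‖ ∂(μ.prod ν) := by
  refine (norm_integral_le_integral_norm _).trans_eq ?_
  simp only [norm_mul, Circle.norm_coe, one_mul]

variable (μ ν) in
/-- The reconstruction formula for functions in the Feichtinger algebra. -/
theorem exists_reconstruction :
    ∃ c : ℂ, ∀ ξ : G → ℂ, MemLp ξ 2 μ → Integrable (autoSTFT μ ξ) (μ.prod ν) →
      ∀ h : G → ℂ, Continuous h → HasCompactSupport h →
        (fun t => ξ t * ∫ s, star (ξ s) * h s ∂μ) =ᵐ[μ]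
          fun t => c * stftSynthesis μ ν (autoSTFT μ ξ) h t := by
  obtain ⟨c, hc⟩ := exists_parseval μ ν
  refine ⟨c, fun ξ hξ hV h hh hhs => ?_⟩
  have hR : Continuous fun t => c * stftSynthesis μ ν (autoSTFT μ ξ) h t :=
    continuous_const.mul (continuous_stftSynthesis hV hh hhs)
  have hξl : LocallyIntegrable ξ μ := hξ.locallyIntegrable (by norm_num)
  have hCl : LocallyIntegrable (fun t => ξ t * ∫ s, star (ξ s) * h s ∂μ) μ := by
    have := hξl.smul (∫ s, star (ξ s) * h s ∂μ)
    refine this.congr (Filter.Eventually.of_forall fun t => ?_)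
    simp [mul_comm]
  obtain ⟨C, hC⟩ := exists_norm_le_of_hasCompactSupport hh hhs
  rw [← sub_ae_eq_zero]
  refine ae_eq_zero_of_forall_integral_compactlySupported (hCl.sub hR.locallyIntegrable)
    fun k hk hks => ?_
  have hki : Integrable k μ := hk.integrable_of_hasCompactSupport hks
  have hi : ∀ {D : G → ℂ}, LocallyIntegrable D μ → Integrable (fun t => k t * D t) μ :=
    fun hD => hD.integrable_smul_left_of_hasCompactSupport hk hks
  simp only [Pi.sub_apply, mul_sub]
  rw [integral_sub (hi hCl) (hi hR.locallyIntegrable), sub_eq_zero]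
  have hξh : Integrable (fun s => star (ξ s) * h s) μ := by
    have h1 : LocallyIntegrable (fun s => star (ξ s)) μ := hξ.star.locallyIntegrable (by norm_num)
    have := h1.integrable_smul_left_of_hasCompactSupport hh hhs
    refine this.congr (Filter.Eventually.of_forall fun t => ?_)
    simp [mul_comm]
  -- The substitution s = x⁻¹t, on the product space, provides the integrability required by Fubini
  -- in `hL`.
  have hshear : MeasurePreserving (fun z : G × G => (z.1, z.1 / z.2)) (μ.prod μ) (μ.prod μ) :=
    (MeasurePreserving.id μ).skew_product (g := fun t x => t / x)
      (measurable_fst.div measurable_snd)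
      (Filter.Eventually.of_forall fun t => (Measure.measurePreserving_div_left μ t).map_eq)
  have hL : ∫ t, k t * (ξ t * ∫ s, star (ξ s) * h s ∂μ) ∂μ =
      ∫ x, ∫ t, (ξ t * star (ξ (x⁻¹ * t))) * (k t * h (x⁻¹ * t)) ∂μ ∂μ := by
    have h1 : ∀ t, k t * (ξ t * ∫ s, star (ξ s) * h s ∂μ) =
        ∫ x, (ξ t * star (ξ (x⁻¹ * t))) * (k t * h (x⁻¹ * t)) ∂μ := by
      intro t
      rw [← integral_div_left_eq_self (fun s => star (ξ s) * h s) μ t, ← integral_const_mul,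
        ← integral_const_mul]
      congr 1
      ext x
      rw [div_eq_mul_inv, mul_comm t]
      ring
    simp only [h1]
    refine integral_integral_swap ?_
    refine (hshear.integrable_comp_of_integrable ((hi hξl).mul_prod hξh)).congr
      (Filter.Eventually.of_forall fun z => ?_)
    simp only [Function.uncurry, Function.comp_apply, div_eq_mul_inv, mul_comm z.1 z.2⁻¹]
    ring
  have hW : Integrable (fun p : (G × PontryaginDual G) × G =>
      autoSTFT μ ξ p.1 * (k p.2 * ((p.1.2 p.2 : ℂ) * h (p.1.1⁻¹ * p.2)))) ((μ.prod ν).prod μ) := by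
    have h1 := (hV.mul_prod hki).mul_bdd (c := C)
      (g := fun p => (p.1.2 p.2 : ℂ) * h (p.1.1⁻¹ * p.2)) ?_ ?_
    · refine h1.congr (Filter.Eventually.of_forall fun p => ?_)
      simp only
      ring
    · refine Continuous.aestronglyMeasurable (Continuous.mul ?_ (by fun_prop))
      exact continuous_dual_coe.comp ((continuous_snd.comp continuous_fst).prodMk continuous_snd)
    · refine Filter.Eventually.of_forall fun p => ?_
      rw [norm_mul, Circle.norm_coe, one_mul]
      exact hC _
  have hRR : ∫ t, k t * (c * stftSynthesis μ ν (autoSTFT μ ξ) h t) ∂μ =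
      c * ∫ x, ∫ ω, ∫ t, autoSTFT μ ξ (x, ω) * (k t * ((ω t : ℂ) * h (x⁻¹ * t))) ∂μ ∂ν ∂μ := by
    rw [← integral_prod _ hW.integral_prod_left, integral_integral_swap hW, ← integral_const_mul]
    congr 1
    ext t
    rw [mul_left_comm, stftSynthesis, ← integral_const_mul (k t)]
    congr 2
    ext z
    ring
  rw [hL, hRR, ← integral_const_mul]
  refine integral_congr_ae ?_
  filter_upwards [hV.prod_right_ae] with x hx
  have hm : Continuous fun t => star (k t * h (x⁻¹ * t)) := by fun_prop
  have hms : HasCompactSupport fun t => star (k t * h (x⁻¹ * t)) :=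
    hks.mul_right.comp_left (star_zero ℂ)
  have hx' : Integrable (groupFourier μ fun t => ξ t * star (ξ (x⁻¹ * t))) ν := by
    refine hx.congr (Filter.Eventually.of_forall fun ω => ?_)
    exact autoSTFT_eq_groupFourier ξ x ω
  -- Parseval in t at fixed x: the Fourier transform of t ↦ ξ(t) conj ξ(x⁻¹t) is V(x, ·), integrable
  -- for almost every x, and the test function is conj(k(t) h(x⁻¹t)).
  have h1 := hc _ (integrable_mul_star_translate hξ x) hx' _ hm hms
  simp only [star_star, star_groupFourier_star] at h1
  rw [h1]
  congr 2
  ext ω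
  rw [← autoSTFT_eq_groupFourier, ← integral_const_mul]
  congr 1
  ext t
  ring

theorem exists_compactlySupported_pairing_ne_zero {ξ : G → ℂ} (hξ : MemLp ξ 2 μ)
    (h0 : ¬ ξ =ᵐ[μ] 0) :
    ∃ h : G → ℂ, Continuous h ∧ HasCompactSupport h ∧ ∫ s, star (ξ s) * h s ∂μ ≠ 0 := by
  by_contra! hc
  have h1 : LocallyIntegrable (fun s => star (ξ s)) μ := hξ.star.locallyIntegrable (by norm_num)
  have h2 := ae_eq_zero_of_forall_integral_compactlySupported h1 fun k hk hks => by
    rw [← hc k hk hks]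
    congr 1
    ext s
    ring
  refine h0 ?_
  filter_upwards [h2] with s hs
  simpa using hs

/-! ### Summability along a discrete subgroup -/

theorem finite_subgroup_inter_compact {Λ : Subgroup G} [DiscreteTopology Λ] {Q : Set G}
    (hQ : IsCompact Q) : {l : Λ | (l : G) ∈ Q}.Finite := by
  have hcl : IsClosed (Λ : Set G) := Subgroup.isClosed_of_discrete
  exact (hcl.isClosedEmbedding_subtypeVal.isCompact_preimage hQ).finite_of_discrete

-- If l⁻¹x and l₀⁻¹x both lie in Q, their quotient l⁻¹l₀ lies in QQ⁻¹, which is compact and meets Λ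
-- in a finite set independent of x.
open Pointwise in
theorem exists_card_translates_le {Λ : Subgroup G} [DiscreteTopology Λ] {Q : Set G}
    (hQ : IsCompact Q) :
    ∃ N : ℕ, ∀ (x : G) (s : Finset Λ), (∀ l ∈ s, (l : G)⁻¹ * x ∈ Q) → s.card ≤ N := by
  have hfin := finite_subgroup_inter_compact (Λ := Λ) (hQ.mul hQ.inv)
  refine ⟨hfin.toFinset.card, fun x s hs => ?_⟩
  rcases s.eq_empty_or_nonempty with rfl | ⟨l₀, hl₀⟩
  · simp
  · refine Finset.card_le_card_of_injOn (fun l => l⁻¹ * l₀) (fun l hl => ?_) (fun a _ b _ hab => ?_)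
    · simp only [Set.Finite.coe_toFinset, Set.mem_ofPred_eq]
      refine Set.mem_mul.2 ⟨(l : G)⁻¹ * x, hs l hl, ((l₀ : G)⁻¹ * x)⁻¹,
        Set.inv_mem_inv.2 (hs l₀ hl₀), ?_⟩
      simp only [Subgroup.coe_mul, Subgroup.coe_inv]
      group
    · exact inv_injective (mul_right_cancel hab)

/-- Each point lies in at most N of the domains of integration, so every finite partial sum is at
most N ∫|V|. -/
theorem summable_setIntegral_translates {Λ : Subgroup G} [DiscreteTopology Λ] {Q : Set G}
    (hQ : IsCompact Q) {V : G × PontryaginDual G → ℂ} (hV : Integrable V (μ.prod ν)) :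
    Summable fun l : Λ => ∫ z in {z | (l : G)⁻¹ * z.1 ∈ Q}, ‖V z‖ ∂(μ.prod ν) := by
  obtain ⟨N, hN⟩ := exists_card_translates_le (Λ := Λ) hQ
  have hE : ∀ l : Λ, MeasurableSet {z : G × PontryaginDual G | (l : G)⁻¹ * z.1 ∈ Q} := fun l =>
    ((measurable_const_mul _).comp measurable_fst) hQ.measurableSet
  refine summable_of_sum_le (c := N * ∫ z, ‖V z‖ ∂(μ.prod ν))
    (fun l => integral_nonneg fun z => norm_nonneg _) fun s => ?_
  simp only [← integral_indicator (hE _)]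
  rw [← integral_finsetSum _ fun l _ => hV.norm.indicator (hE l), ← integral_const_mul]
  refine integral_mono (integrable_finsetSum _ fun l _ => hV.norm.indicator (hE l))
    (hV.norm.const_mul _) fun z => ?_
  classical
  simp only [Set.indicator_apply, Set.mem_ofPred_eq]
  rw [← Finset.sum_filter, Finset.sum_const, nsmul_eq_mul]
  refine mul_le_mul_of_nonneg_right ?_ (norm_nonneg _)
  exact_mod_cast hN z.1 _ fun l hl => (Finset.mem_filter.1 hl).2

theorem existsUnique_continuous_representative (ξ : Lp ℂ 2 μ)
    (hξ : ξ ∈ feichtingerAlgebra μ ν) : ∃! f : C(G, ℂ), f =ᵐ[μ] ξ := by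
  have huniq : ∀ f g : C(G, ℂ), f =ᵐ[μ] ξ → g =ᵐ[μ] ξ → f = g := fun f g hf hg =>
    DFunLike.coe_injective ((f.continuous.ae_eq_iff_eq μ g.continuous).1 (hf.trans hg.symm))
  by_cases h0 : ξ =ᵐ[μ] 0
  · exact ⟨0, h0.symm, fun f hf => huniq f 0 hf h0.symm⟩
  · obtain ⟨h, hh, hhs, hne⟩ := exists_compactlySupported_pairing_ne_zero (Lp.memLp ξ) h0
    obtain ⟨c, hc⟩ := exists_reconstruction μ ν
    have hV : Integrable (autoSTFT μ ξ) (μ.prod ν) := hξ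
    have h1 := hc ξ (Lp.memLp ξ) hV h hh hhs
    refine ⟨⟨fun t => c * stftSynthesis μ ν (autoSTFT μ ξ) h t / ∫ s, star (ξ s) * h s ∂μ,
      (continuous_const.mul (continuous_stftSynthesis hV hh hhs)).div_const _⟩, ?_,
      fun f hf => huniq _ _ hf ?_⟩ <;>
    · filter_upwards [h1] with t ht
      change c * stftSynthesis μ ν (autoSTFT μ ξ) h t / (∫ s, star (ξ s) * h s ∂μ) = ξ t
      rw [← ht, mul_div_cancel_right₀ _ hne]

open Pointwise in
/-- The continuous representative of an element of the Feichtinger algebra is dominated, uniformly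
over compact sets, by a summable family along a discrete subgroup. -/
theorem exists_summable_bound {Λ : Subgroup G} [DiscreteTopology Λ] (ξ : Lp ℂ 2 μ)
    (hξ : ξ ∈ feichtingerAlgebra μ ν) (f : C(G, ℂ)) (hf : f =ᵐ[μ] ξ) {K : Set G}
    (hK : IsCompact K) :
    ∃ b : Λ → ℝ, Summable b ∧ ∀ t ∈ K, ∀ l : Λ, ‖f (t * l)‖ ≤ b l := by
  by_cases h0 : ξ =ᵐ[μ] 0
  · have hf0 : (f : G → ℂ) = 0 :=
      (f.continuous.ae_eq_iff_eq μ continuous_zero).1 (hf.trans h0)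
    exact ⟨0, summable_zero, fun t _ l => by simp [hf0]⟩
  obtain ⟨h, hh, hhs, hne⟩ := exists_compactlySupported_pairing_ne_zero (Lp.memLp ξ) h0
  obtain ⟨c, hc⟩ := exists_reconstruction μ ν
  obtain ⟨C, hC⟩ := exists_norm_le_of_hasCompactSupport hh hhs
  have hV : Integrable (autoSTFT μ ξ) (μ.prod ν) := hξ
  set A := ∫ s, star (ξ s) * h s ∂μ
  have hall : ∀ t, f t * A = c * stftSynthesis μ ν (autoSTFT μ ξ) h t := by
    refine congrFun ((Continuous.ae_eq_iff_eq μ (f.continuous.mul continuous_const)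
      (continuous_const.mul (continuous_stftSynthesis hV hh hhs))).1 ?_)
    filter_upwards [hf, hc ξ (Lp.memLp ξ) hV h hh hhs] with t h1 h2
    change f t * A = c * stftSynthesis μ ν (autoSTFT μ ξ) h t
    rw [h1]
    exact h2
  have hQ : IsCompact (K * (tsupport h)⁻¹) := hK.mul hhs.isCompact.inv
  -- For t in K, h(x⁻¹tl) ≠ 0 puts l⁻¹x in K (supp h)⁻¹, so only this part of V enters the synthesis
  -- at tl; C bounds |h|.
  refine ⟨fun l => ‖c‖ / ‖A‖ * C * ∫ z in {z | (l : G)⁻¹ * z.1 ∈ K * (tsupport h)⁻¹},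
    ‖autoSTFT μ ξ z‖ ∂(μ.prod ν), (summable_setIntegral_translates hQ hV).mul_left _,
    fun t ht l => ?_⟩
  have hE : MeasurableSet {z : G × PontryaginDual G | (l : G)⁻¹ * z.1 ∈ K * (tsupport h)⁻¹} :=
    ((measurable_const_mul _).comp measurable_fst) hQ.measurableSet
  have h1 : f (t * l) = c * stftSynthesis μ ν (autoSTFT μ ξ) h (t * l) / A := by
    rw [← hall, mul_div_cancel_right₀ _ hne]
  have h2 : ∫ z, ‖autoSTFT μ ξ z‖ * ‖h (z.1⁻¹ * (t * l))‖ ∂(μ.prod ν) ≤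
      C * ∫ z in {z | (l : G)⁻¹ * z.1 ∈ K * (tsupport h)⁻¹}, ‖autoSTFT μ ξ z‖ ∂(μ.prod ν) := by
    rw [← integral_indicator hE, ← integral_const_mul]
    refine integral_mono_of_nonneg (Filter.Eventually.of_forall fun z => by positivity)
      ((hV.norm.indicator hE).const_mul C) (Filter.Eventually.of_forall fun z => ?_)
    simp only
    by_cases hz : z ∈ {z : G × PontryaginDual G | (l : G)⁻¹ * z.1 ∈ K * (tsupport h)⁻¹}
    · rw [Set.indicator_of_mem hz, mul_comm]
      exact mul_le_mul_of_nonneg_right (hC _) (norm_nonneg _)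
    · have h3 : h (z.1⁻¹ * (t * l)) = 0 := by
        by_contra hcon
        refine hz (Set.mem_mul.2 ⟨t, ht, (z.1⁻¹ * (t * l))⁻¹,
          Set.inv_mem_inv.2 (subset_tsupport _ hcon), ?_⟩)
        simp only [mul_inv_rev, inv_inv]
        rw [mul_comm (l : G)⁻¹ t⁻¹, mul_assoc, mul_inv_cancel_left]
      rw [Set.indicator_of_notMem hz, h3, norm_zero, mul_zero, mul_zero]
  rw [h1, norm_div, norm_mul, mul_div_right_comm]
  simp only [mul_assoc]
  exact mul_le_mul_of_nonneg_left ((norm_stftSynthesis_le _ _ _).trans h2) (by positivity)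

/-! ### The Zak transform -/

theorem norm_zakTerm (Λ : Subgroup G) (f : G → ℂ) (z : G × PontryaginDual G) (l : Λ) :
    ‖zakTerm Λ f z l‖ = ‖f (z.1 * l)‖ := by
  rw [zakTerm, norm_mul, Circle.norm_coe, mul_one]

theorem continuous_zakTerm (Λ : Subgroup G) (f : C(G, ℂ)) (l : Λ) :
    Continuous fun z => zakTerm Λ f z l := by
  refine Continuous.mul (by fun_prop) ?_
  exact continuous_dual_coe.comp (continuous_snd.prodMk continuous_const)

theorem continuous_zak {Λ : Subgroup G} [DiscreteTopology Λ] (ξ : Lp ℂ 2 μ)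
    (hξ : ξ ∈ feichtingerAlgebra μ ν) (f : C(G, ℂ)) (hf : f =ᵐ[μ] ξ) :
    Continuous (zak Λ f) := by
  rw [continuous_iff_continuousAt]
  intro z₀
  obtain ⟨K, hK, hKn⟩ := exists_compact_mem_nhds z₀.1
  obtain ⟨b, hb, hfb⟩ := exists_summable_bound (Λ := Λ) ξ hξ f hf hK
  have h1 : ContinuousOn (zak Λ f) (Prod.fst ⁻¹' K) :=
    continuousOn_tsum (fun l => (continuous_zakTerm Λ f l).continuousOn) hb fun l z hz => by
      rw [norm_zakTerm]
      exact hfb _ hz l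
  exact h1.continuousAt (continuous_fst.continuousAt hKn)

theorem zak_quasiperiodic (Λ : Subgroup G) (f : G → ℂ) (x : G) (ω : PontryaginDual G) {l : G}
    (hl : l ∈ Λ) {τ : PontryaginDual G} (hτ : τ ∈ annihilator Λ) :
    zak Λ f (x * l, ω * τ) = star (ω l : ℂ) * zak Λ f (x, ω) := by
  rw [zak, zak, ← tsum_mul_left, ← (Equiv.mulLeft (⟨l, hl⟩ : Λ)).tsum_eq
    fun m => star (ω l : ℂ) * zakTerm Λ f (x, ω) m]
  refine tsum_congr fun m => ?_
  have h1 : ((ω * τ) (m : G) : ℂ) = ω (m : G) := by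
    change ((ω (m : G) * τ (m : G) : Circle) : ℂ) = _
    rw [hτ _ m.2, mul_one]
  have h2 : star (ω l : ℂ) * (ω l : ℂ) = 1 := by
    rw [mul_comm, RCLike.star_def, Complex.mul_conj, Circle.normSq_coe, Complex.ofReal_one]
  simp only [zakTerm, Equiv.coe_mulLeft, Subgroup.coe_mul, h1, map_mul, Circle.coe_mul, mul_assoc]
  linear_combination -(f (x * (l * m)) * (ω (m : G) : ℂ)) * h2

theorem zak_congr_ae {Λ : Subgroup G} [DiscreteTopology Λ] {f g : G → ℂ} (hfg : g =ᵐ[μ] f) :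
    zak Λ g =ᵐ[μ.prod ν] zak Λ f := by
  -- A discrete separable space is countable, so the exceptional null sets of all translates by Λ
  -- have null union.
  have : Countable Λ := TopologicalSpace.separableSpace_iff_countable.1 inferInstance
  have h1 : ∀ᵐ x ∂μ, ∀ l : Λ, g (x * l) = f (x * l) := by
    rw [ae_all_iff]
    intro l
    exact (measurePreserving_mul_right μ (l : G)).quasiMeasurePreserving.ae_eq_comp hfg
  filter_upwards [Measure.quasiMeasurePreserving_fst.ae h1] with z hz
  exact tsum_congr fun l => by rw [zakTerm, zakTerm, hz l]

end Feichtinger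
end

theorem mainTheorem9 {G : Type*} [CommGroup G] [TopologicalSpace G] [IsTopologicalGroup G]
    [LocallyCompactSpace G] [T2Space G] [SecondCountableTopology G]
    [MeasurableSpace G] [BorelSpace G]
    [MeasurableSpace (PontryaginDual G)] [BorelSpace (PontryaginDual G)]
    (μ : Measure G) [μ.IsHaarMeasure]
    (ν : Measure (PontryaginDual G)) [ν.IsHaarMeasure]
    (Λ : Subgroup G) (hΛ : IsLattice Λ)
    (ξ : Lp ℂ 2 μ) (hξ : ξ ∈ feichtingerAlgebra μ ν) :
    (∃! f : C(G, ℂ), f =ᵐ[μ] ξ) ∧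
    ∀ f : C(G, ℂ), f =ᵐ[μ] ξ →
      (∀ z : G × PontryaginDual G, Summable (zakTerm Λ f z)) ∧
      Continuous (zak Λ f) ∧
      zak Λ f ∈ continuousQuasiperiodic Λ ∧
      ∀ g : G → ℂ, g =ᵐ[μ] ξ → zak Λ g =ᵐ[μ.prod ν] zak Λ f := by
  have := hΛ.discrete
  refine ⟨existsUnique_continuous_representative ξ hξ, fun f hf => ⟨fun z => ?_, ?_, ⟨?_, ?_⟩, ?_⟩⟩
  · obtain ⟨b, hb, hfb⟩ := exists_summable_bound (Λ := Λ) ξ hξ f hf (isCompact_singleton (x := z.1))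
    refine Summable.of_norm_bounded hb fun l => ?_
    rw [norm_zakTerm]
    exact hfb _ rfl l
  · exact continuous_zak ξ hξ f hf
  · exact continuous_zak ξ hξ f hf
  · exact fun x ω l hl τ hτ => zak_quasiperiodic Λ f x ω hl hτ
  · exact fun g hg => zak_congr_ae (hg.trans hf.symm)
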